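/- Let $N\ge 1$, and let the vertices of the coloured $N$-cube $A_N$ be the elements of $\mathbb F_2^N$, white if of even weight and black if of odd weight; an edge of colour $c\in\{1,\dots,N\}$ joins two vertices that differ exactly in the $c$-th coordinate. Colours are read cyclically (so $N+1=1$). Let $X_N$ be the closed surface obtained by attaching a 2-cell to $A_N$ along every 2-coloured loop (4-cycle) of colours $i,i+1$, for each of the $N$ cyclically adjacent pairs $i/(i+1)$. Let $B_N$ be the Riemann sphere with white vertex $0$, black vertex $\infty$, the ray of argument $2\pi c/N$ as edge of colour $c$, and hence with face centres the $N$-th roots of $-1$; the centre of its $i/(i+1)$ face is $\zeta_i=e^{\pi\mathrm i(2i+1)/N}$. Let $f:X_N\to B_N$ be the map that sends white vertices to $0$, black vertices to $\infty$, edges of colour $c$ to the edge of colour $c$, and every $i/(i+1)$ face onto the $i/(i+1)$ face of $B_N$ by the double cover $z\mapsto z^2$ of the disc, branched over $\zeta_i$, followed by the map $u\mapsto \zeta_i\bigl(\tfrac{1-u}{1+u}\bigr)^{2/N}$ of the disc onto that face. (Thus $\tilde\beta\circ f$, with $\tilde\beta(x)=x^N/(x^N+1)$, is the Belyi map $z\mapsto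 -(1-z^2)^2/(4z^2)$ on each face, where the white vertices of the face are $z=\pm1$.) The vertices can be labelled $1_w,\dots,(2^{N-1})_w$ (white) and $1_b,\dots,(2^{N-1})_b$ (black) so that colour $1$ connects $j_w$ with $j_b$ for all $j$, and for $2\le c\le N$ colour $c$ connects $j_w$ with $(j+2^{c-2})_b$ if $1\le j \bmod 2^{c-1}\le 2^{c-2}$, and with $(j-2^{c-2})_b$ otherwise. **Theorem.** The map $f$ is continuous, and away from the centres of the faces it is a covering map of degree $2^{N-1}$ whose fibre over $0$ is the set of white vertices. For every labelling as above, its monodromy group (the image of $\pi_1(B_N\setminus\{x: x^N=-1\},0)$ in the symmetric group of this fibre, identified with $S_{2^{N-1}}$ through the labels of the white vertices) is generated by the permutations $\rho_i$, $1\le i\le N-1$, where $$\rho_1=(1,2)(3,4)\cdots(2^{N-1}-1,2^{N-1}),$$ $$\rho_i=\prod_{\substack{1\le j\le 2^{N-1}\\ 1\le j\bmod 2^{i}\le 2^{i-2}}}(j,\;j+2^{i-2}+2^{i-1})\,(j+2^{i-2},\;j+2^{i-1})\qquad(i\ge 2).$$ Each $\rho_i$ with $1\le i\le N-1$ is an involution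 ($\rho_i\neq1$, $\rho_i^2=1$) and is the monodromy along a small loop based at $0$ around $\zeta_i$, namely $t\mapsto\zeta_i\bigl(\tfrac32(1-e^{2\pi\mathrm i t})\bigr)^{2/N}$, $0\le t\le1$. It exchanges two labels $j\neq j'$ if and only if $j_w$ and $j'_w$ are the two white vertices of a common $i/(i+1)$-coloured face. -/

import Mathlib

open scoped ComplexConjugate

namespace CubeSurface

/-! ### The coloured cube

The vertices of the coloured `N`-cube are the elements of `𝔽₂^N`. The colours `1, …, N` are the
elements `0, …, N - 1` of `Fin N`; addition in `Fin N` is cyclic, so `k ↦ k + 1` is the rainbow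
`(1, 2, …, N)`. -/

/-- The element of `Fin N` that stands for the colour `i ∈ {1, …, N}`. -/
def colour (N : ℕ) [NeZero N] (i : ℕ) : Fin N := Fin.ofNat N (i - 1)

/-- The other end of the edge of colour `k` at the vertex `v`. -/
def flipAt {N : ℕ} (k : Fin N) (v : Fin N → ZMod 2) : Fin N → ZMod 2 := v + Pi.single k 1

/-- White vertices: even weight. -/
abbrev White (N : ℕ) : Type := {v : Fin N → ZMod 2 // Even (hammingNorm v)}

/-- Black vertices: odd weight. -/
abbrev Black (N : ℕ) : Type := {v : Fin N → ZMod 2 // Odd (hammingNorm v)}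

/-- The vertices of the `k`/`l` 2-coloured loop through `v`. -/
def twoColouredLoop {N : ℕ} (k l : Fin N) (v : Fin N → ZMod 2) : Set (Fin N → ZMod 2) :=
  {v, flipAt k v, flipAt l (flipAt k v), flipAt l v}

/-! ### The surface `X_N`

A 2-cell (the closed unit disc) is attached along every `k`/`(k+1)` 2-coloured loop. Seen from a
white vertex `v` on it, the loop is parametrised by the unit circle: `1 ↦ v`,
`i ↦ flipAt k v`, `-1 ↦ flipAt (k+1) (flipAt k v)`, `-i ↦ flipAt (k+1) v`, and the four arcs between these
points are the edges of colours `k`, `k+1`, `k`, `k+1` in this order. -/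

/-- The closed unit disc. -/
abbrev Disc : Type := Metric.closedBall (0 : ℂ) 1

/-- The identifications: `(k, v, z)` is the point `z` of the `k`/`(k+1)` face seen from `v`. -/
inductive Glue (N : ℕ) [NeZero N] : Fin N × White N × Disc → Fin N × White N × Disc → Prop
  /-- The same face, seen from its two white vertices. -/
  | turn (k : Fin N) (v v' : White N) (z z' : Disc)
      (hv : v'.1 = flipAt (k + 1) (flipAt k v.1)) (hz : (z' : ℂ) = -z) :
      Glue N (k, v, z) (k, v', z')
  /-- The edge of colour `k + 1` at `v` is the first arc of the `(k+1)`/`(k+2)` face seen from `v`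
  and, reversed, the last arc of the `k`/`(k+1)` face seen from `v`. -/
  | edge (k : Fin N) (v : White N) (z z' : Disc)
      (hnorm : ‖(z : ℂ)‖ = 1) (hre : 0 ≤ (z : ℂ).re) (him : 0 ≤ (z : ℂ).im)
      (hz : (z' : ℂ) = conj (z : ℂ)) :
      Glue N (k + 1, v, z) (k, v, z')

end CubeSurface

open CubeSurface in
/-- The surface `X_N`, with the quotient topology. -/
def CubeSurface (N : ℕ) [NeZero N] : Type := Quot (Glue N)

namespace CubeSurface

instance (N : ℕ) [NeZero N] : TopologicalSpace (CubeSurface N) :=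
  inferInstanceAs (TopologicalSpace (Quot (Glue N)))

/-- The point of `X_N` that is the white vertex `v`. -/
def whitePoint {N : ℕ} [NeZero N] (v : White N) : CubeSurface N :=
  Quot.mk _ (0, v, ⟨1, by simp⟩)

/-! ### The covering `f : X_N → B_N`

`B_N` is the Riemann sphere `OnePoint ℂ` with a white vertex at `0`, a black vertex at `∞` and the
ray of argument `2πj/N` as the edge of colour `j ∈ {1, …, N}`. The centre of the `i`/`(i+1)` face
is the root `exp (πi(2i+1)/N)` of `-1`. -/

/-- The centre of the face of `B_N` between the edges `k` and `k + 1` (as elements of `Fin N`). -/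
noncomputable def faceCentre (N : ℕ) (k : Fin N) : ℂ :=
  Complex.exp (Real.pi * Complex.I * (2 * (k : ℕ) + 3) / N)

/-- `f` on a face: the double cover `z ↦ z²` of the disc, branched at the centre of the face,
followed by the map (a homeomorphism if `N ≥ 2`, conformal in the interior) of the disc onto the
closed sector between the edges `k` and `k + 1` that sends `1, 0, -1` to `0, faceCentre N k, ∞`. -/
noncomputable def faceMap (N : ℕ) (k : Fin N) (z : ℂ) : OnePoint ℂ :=
  open Classical in
  if z ^ 2 = -1 then OnePoint.infty
  else ((faceCentre N k * ((1 - z ^ 2) / (1 + z ^ 2)) ^ (2 / N : ℂ) : ℂ) : OnePoint ℂ)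

theorem faceMap_neg (N : ℕ) (k : Fin N) (z : ℂ) : faceMap N k (-z) = faceMap N k z := by
  simp [faceMap]

theorem faceCentre_succ (N : ℕ) [NeZero N] (k : Fin N) :
    faceCentre N (k + 1) = faceCentre N k * Complex.exp (2 * Real.pi * Complex.I / N) := by
  have hN : (N : ℂ) ≠ 0 := by exact_mod_cast NeZero.ne N
  have hk := k.2
  unfold faceCentre
  rw [← Complex.exp_add]
  rcases Nat.lt_or_ge (k.1 + 1) N with h | h
  · have : ((k + 1 : Fin N) : ℕ) = k.1 + 1 := by
      rw [Fin.val_add, Fin.val_one', Nat.add_mod_mod, Nat.mod_eq_of_lt h]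
    rw [this]
    congr 1
    push_cast
    ring
  · have hk' : k.1 + 1 = N := by omega
    have : ((k + 1 : Fin N) : ℕ) = 0 := by
      rw [Fin.val_add, Fin.val_one', Nat.add_mod_mod, hk', Nat.mod_self]
    rw [this, Complex.exp_eq_exp_iff_exists_int]
    refine ⟨-1, ?_⟩
    have h2 : (k.1 : ℂ) = N - 1 := by
      rw [eq_sub_iff_add_eq]; exact_mod_cast hk'
    rw [h2]
    field_simp
    push_cast
    ring

theorem faceMap_edge (N : ℕ) [NeZero N] (k : Fin N) (z : ℂ) (hnorm : ‖z‖ = 1)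
    (hre : 0 ≤ z.re) (him : 0 ≤ z.im) : faceMap N (k + 1) z = faceMap N k (conj z) := by
  have hN : (N : ℂ) ≠ 0 := by exact_mod_cast NeZero.ne N
  have hzz : z * conj z = 1 := by rw [Complex.mul_conj']; simp [hnorm]
  have hz0 : z ≠ 0 := by rintro rfl; simp at hzz
  have hc0 : conj z ≠ 0 := by simpa using hz0
  have hadd : z + conj z = 2 * (z.re : ℂ) := by rw [Complex.add_conj]; push_cast; ring
  have hsub : z - conj z = 2 * (z.im : ℂ) * Complex.I := by
    rw [Complex.sub_conj]; push_cast; ring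
  have h1 : 1 + z ^ 2 = 2 * z.re * z := by rw [← hadd, ← hzz]; ring
  have h2 : 1 + (conj z) ^ 2 = 2 * z.re * conj z := by rw [← hadd, ← hzz]; ring
  have h3 : 1 - z ^ 2 = -(2 * (z.im : ℂ) * Complex.I) * z := by rw [← hsub, ← hzz]; ring
  have h4 : 1 - (conj z) ^ 2 = (2 * (z.im : ℂ) * Complex.I) * conj z := by
    rw [← hsub, ← hzz]; ring
  unfold faceMap
  by_cases ha : z.re = 0
  · rw [if_pos, if_pos]
    · rw [ha, Complex.ofReal_zero] at h2; linear_combination h2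
    · rw [ha, Complex.ofReal_zero] at h1; linear_combination h1
  · have ha' : (z.re : ℂ) ≠ 0 := by exact_mod_cast ha
    rw [if_neg, if_neg]
    rotate_left
    · intro h
      have : 2 * (z.re : ℂ) * conj z = 0 := by rw [← h2, h]; ring
      simp [ha', hc0] at this
    · intro h
      have : 2 * (z.re : ℂ) * z = 0 := by rw [← h1, h]; ring
      simp [ha, hz0] at this
    have hr : 0 ≤ z.im / z.re := div_nonneg him hre
    have e1 : (1 - z ^ 2) / (1 + z ^ 2) = ((z.im / z.re : ℝ) : ℂ) * -Complex.I := by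
      rw [h1, h3]; push_cast; field_simp
    have e2 : (1 - (conj z) ^ 2) / (1 + (conj z) ^ 2) = ((z.im / z.re : ℝ) : ℂ) * Complex.I := by
      rw [h2, h4]; push_cast; field_simp
    rw [e1, e2, faceCentre_succ]
    congr 1
    rcases hr.eq_or_lt with h0 | h0
    · rw [← h0]
      simp [Complex.zero_cpow, hN]
    · have hrc : ((z.im / z.re : ℝ) : ℂ) ≠ 0 := by exact_mod_cast h0.ne'
      have hI : ∀ w : ℂ, w ≠ 0 → (((z.im / z.re : ℝ) : ℂ) * w) ^ (2 / N : ℂ)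
          = Complex.exp (Real.log (z.im / z.re) * (2 / N)) * Complex.exp (Complex.log w * (2 / N)) := by
        intro w hw
        rw [Complex.cpow_def_of_ne_zero (mul_ne_zero hrc hw), Complex.log_ofReal_mul h0 hw,
          add_mul, Complex.exp_add]
      rw [hI _ (neg_ne_zero.2 Complex.I_ne_zero), hI _ Complex.I_ne_zero, Complex.log_neg_I,
        Complex.log_I]
      have : Complex.exp (2 * Real.pi * Complex.I / N)
          * Complex.exp (-(Real.pi / 2) * Complex.I * (2 / N))
          = Complex.exp (Real.pi / 2 * Complex.I * (2 / N)) := by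
        rw [← Complex.exp_add]; congr 1; field_simp; ring
      rw [← this]
      ring

/-- The map `f : X_N → B_N`. With `β̃ x = x ^ N / (x ^ N + 1)`, the composition `β̃ ∘ f` is
`z ↦ -(1 - z ^ 2) ^ 2 / (4 * z ^ 2)` on every face: it sends the white vertices to `0`, the black
ones to `1`, the edges to `(0, 1)` and the centres of the faces to `∞` (double poles). -/
noncomputable def coveringMap (N : ℕ) [NeZero N] : CubeSurface N → OnePoint ℂ :=
  Quot.lift (fun x => faceMap N x.1 x.2.2) (by
    rintro _ _ (⟨k, v, v', z, z', -, hz⟩ | ⟨k, v, z, z', hnorm, hre, him, hz⟩)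
    · simp only [hz, faceMap_neg]
    · simp only [hz, faceMap_edge N k _ hnorm hre him])

/-- The centres of the faces of `B_N`: the `N`-th roots of `-1`. -/
def faceCentres (N : ℕ) : Set (OnePoint ℂ) := {p | ∃ ζ : ℂ, ζ ^ N = -1 ∧ p = (ζ : OnePoint ℂ)}

/-- `B_N` without the centres of its faces. -/
abbrev PuncturedBase (N : ℕ) : Type := ((faceCentres N)ᶜ : Set (OnePoint ℂ))

/-- `X_N` without the centres of its faces. -/
abbrev PuncturedSurface (N : ℕ) [NeZero N] : Type := coveringMap N ⁻¹' (faceCentres N)ᶜ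

/-- The covering `f`, away from the centres of the faces. -/
noncomputable abbrev unramifiedMap (N : ℕ) [NeZero N] : PuncturedSurface N → PuncturedBase N :=
  (faceCentres N)ᶜ.restrictPreimage (coveringMap N)

/-- The white vertex `0` of `B_N`. -/
def basePoint (N : ℕ) [NeZero N] : PuncturedBase N :=
  ⟨((0 : ℂ) : OnePoint ℂ), by
    rintro ⟨ζ, hζ, h⟩
    rw [← OnePoint.coe_injective h, zero_pow (NeZero.ne N)] at hζ
    norm_num at hζ⟩

/-- A small loop based at `0` that lies, apart from `0`, in the open face of `B_N` with centre
`faceCentre N k` and goes once counterclockwise around this centre: the image of the circle with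
diameter `[0, 3]`, which surrounds `1`, under `s ↦ faceCentre N k * s ^ (2 / N)`. -/
noncomputable def faceLoop (N : ℕ) (k : Fin N) (t : ℝ) : ℂ :=
  faceCentre N k *
    ((3 / 2) * (1 - Complex.exp (2 * Real.pi * Complex.I * t))) ^ (2 / N : ℂ)

/-! ### Labels and the permutations `ρ_i` -/

/-- The labels `1, …, 2 ^ (N - 1)`. -/
abbrev Label (N : ℕ) : Type := Finset.Icc 1 (2 ^ (N - 1))

/-- `w j = j_w` and `b j = j_b` label the white and the black vertices in such a way that colour
`1` connects `j_w` with `j_b`, and colour `c ≥ 2` connects `j_w` with `(j + 2 ^ (c - 2))_b` if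
`1 ≤ j mod 2 ^ (c - 1) ≤ 2 ^ (c - 2)` and with `(j - 2 ^ (c - 2))_b` otherwise. -/
structure IsCubeLabelling (N : ℕ) [NeZero N] (w : Label N ≃ White N) (b : Label N ≃ Black N) :
    Prop where
  colour_one : ∀ j : Label N, (b j).1 = flipAt (colour N 1) (w j).1
  colour_ge_two : ∀ c : ℕ, 2 ≤ c → c ≤ N → ∀ j : Label N, ∃ j' : Label N,
    (j' : ℕ) = (if 1 ≤ (j : ℕ) % 2 ^ (c - 1) ∧ (j : ℕ) % 2 ^ (c - 1) ≤ 2 ^ (c - 2)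
      then (j : ℕ) + 2 ^ (c - 2) else (j : ℕ) - 2 ^ (c - 2)) ∧
    (b j').1 = flipAt (colour N c) (w j).1

/-- The transposition `(a, b)` in the symmetric group of the labels. -/
def transposition (N a b : ℕ) : Equiv.Perm (Label N) :=
  if h : a ∈ Finset.Icc 1 (2 ^ (N - 1)) ∧ b ∈ Finset.Icc 1 (2 ^ (N - 1))
  then Equiv.swap ⟨a, h.1⟩ ⟨b, h.2⟩ else 1

/-- `ρ_1 = (1, 2)(3, 4)⋯`, and for `i ≥ 2`, `ρ_i` is the product over all labels `j` with
`1 ≤ j mod 2 ^ i ≤ 2 ^ (i - 2)` of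
`(j, j + 2 ^ (i - 2) + 2 ^ (i - 1)) (j + 2 ^ (i - 2), j + 2 ^ (i - 1))`. -/
def rho (N i : ℕ) : Equiv.Perm (Label N) :=
  if i = 1 then
    (((List.range' 1 (2 ^ (N - 1))).filter fun j => j % 2 = 1).map
      fun j => transposition N j (j + 1)).prod
  else
    (((List.range' 1 (2 ^ (N - 1))).filter
        fun j => 1 ≤ j % 2 ^ i ∧ j % 2 ^ i ≤ 2 ^ (i - 2)).map
      fun j => transposition N j (j + 2 ^ (i - 2) + 2 ^ (i - 1)) *
        transposition N (j + 2 ^ (i - 2)) (j + 2 ^ (i - 1))).prod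

end CubeSurface

/-! Covering. Cut every face along the diameter Re z = 0 joining its two black vertices; what
remains is the disjoint union of the open stars of the white vertices. Each star maps bijectively
onto the sphere minus the rays from the face centres to ∞ (`existsUnique_whiteLabel`). As X_N is
compact and the sphere Hausdorff, f is closed, so the inverse bijections are continuous and this set
is evenly covered, with one sheet per white vertex (`IsClosedMap.isEvenlyCovered_of_label`). In the
same way the stars of the black vertices evenly cover the sphere minus the segments from 0 to the
face centres. The two excluded sets meet only in the face centres
(`notMem_or_notMem_of_notMem_faceCentres`).

Monodromy. Adding an even vector to all vertices is a deck transformation, and these transformations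
act simply transitively on the white vertices. Monodromy commutes with them and vector addition is
commutative, so every monodromy permutation is itself a translation
(`exists_monodromy_eq_translate`). Since a face is a double cover z ↦ z², the loop around its centre
lifts to a path from z = 1 to z = -1: it exchanges the two white vertices of the face and so is the
translation by e_k + e_{k+1} (`monodromy_facePath`). The vectors e_i + e_{i+1} with 1 ≤ i ≤ N - 1
already generate all even vectors (`IsCubeLabelling.exists_mem_closure`), so the remaining loop adds
nothing.

Labels. Write j - 1 in binary. In every admissible labelling, colour c ≥ 2 followed by colour 1
flips digit c - 2, so colours i and i + 1 in succession flip digits i - 2 and i - 1 (only digit 0 if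
i = 1). The cycles of ρ_i perform the same flips (`rho_one_apply`, `rho_add_two_apply`), which gives
`IsCubeLabelling.apply_rho`. -/

namespace CubeSurface

/-! ### The map f on a single face. -/

open Complex Filter Topology

/-- The involution `s ↦ (1 - s) / (1 + s)`, which exchanges the right half-plane and the disc. -/
noncomputable def cayley (s : ℂ) : ℂ := (1 - s) / (1 + s)

theorem cayley_cayley {s : ℂ} (hs : s ≠ -1) : cayley (cayley s) = s := by
  have h : 1 + s ≠ 0 := fun h => hs (by linear_combination h)
  have h' : 1 + (1 - s) / (1 + s) ≠ 0 := by
    have : 1 + (1 - s) / (1 + s) = 2 / (1 + s) := by field_simp; ring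
    rw [this]
    exact div_ne_zero two_ne_zero h
  unfold cayley
  rw [div_eq_iff h']
  field_simp
  ring

theorem cayley_re_nonneg {u : ℂ} (hu : ‖u‖ ≤ 1) : 0 ≤ (cayley u).re := by
  have h : (cayley u).re = (1 - ‖u‖ ^ 2) / normSq (1 + u) := by
    rw [cayley, div_re, ← normSq_eq_norm_sq, normSq_apply u]
    simp only [sub_re, one_re, add_re, sub_im, one_im, add_im]
    ring
  rw [h]
  exact div_nonneg (by nlinarith [norm_nonneg u]) (normSq_nonneg _)

theorem norm_cayley_le {s : ℂ} (hs : 0 ≤ s.re) : ‖cayley s‖ ≤ 1 := by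
  rw [cayley, norm_div]
  refine div_le_one_of_le₀ ?_ (norm_nonneg _)
  rw [← sq_le_sq₀ (norm_nonneg _) (norm_nonneg _), ← normSq_eq_norm_sq, ← normSq_eq_norm_sq,
    normSq_apply, normSq_apply]
  simp only [sub_re, one_re, add_re, sub_im, one_im, add_im]
  nlinarith

theorem cayley_conj (s : ℂ) : cayley (conj s) = conj (cayley s) := by simp [cayley]

theorem cayley_I_mul {r : ℝ} (hr : 0 < r) :
    ‖cayley (r * I)‖ = 1 ∧ (cayley (r * I)).im < 0 := by
  constructor
  · rw [cayley, norm_div, div_eq_one_iff_eq]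
    · rw [← sq_eq_sq₀ (norm_nonneg _) (norm_nonneg _), ← normSq_eq_norm_sq, ← normSq_eq_norm_sq,
        normSq_apply, normSq_apply]
      simp
    · intro h
      have := congrArg re (norm_eq_zero.1 h)
      simp at this
  · have h : (cayley (r * I)).im = -(2 * r) / normSq (1 + r * I) := by
      rw [cayley, div_im]
      simp
      ring
    rw [h]
    refine div_neg_of_neg_of_pos (by linarith) (normSq_pos.2 fun h => ?_)
    have := congrArg re h
    simp at this

theorem faceCentre_ne_zero (N : ℕ) (k : Fin N) : faceCentre N k ≠ 0 := exp_ne_zero _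

theorem faceCentre_pow (N : ℕ) [NeZero N] (k : Fin N) : faceCentre N k ^ N = -1 := by
  have hN : (N : ℂ) ≠ 0 := by exact_mod_cast NeZero.ne N
  rw [faceCentre, ← exp_nat_mul]
  have : (N : ℂ) * (Real.pi * I * (2 * (k : ℕ) + 3) / N)
      = Real.pi * I + ((k.1 + 1 : ℕ) : ℂ) * (2 * Real.pi * I) := by
    field_simp
    push_cast
    ring
  rw [this, exp_add, exp_nat_mul_two_pi_mul_I, exp_pi_mul_I, mul_one]

/-- Allows a sector to be located by an integer, coming from a floor, that is only afterwards
reduced modulo N. -/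
theorem faceCentre_eq_exp (N : ℕ) [NeZero N] (n : ℤ) (k : Fin N) (hk : (k : ℤ) = n % N) :
    faceCentre N k = exp (Real.pi * I * (2 * n + 3) / N) := by
  have hN : (N : ℂ) ≠ 0 := by exact_mod_cast NeZero.ne N
  rw [faceCentre, exp_eq_exp_iff_exists_int]
  refine ⟨-(n / N), ?_⟩
  have h : (n : ℂ) = k.1 + N * ((n / N : ℤ) : ℂ) := by
    have := Int.emod_add_mul_ediv n N
    rw [← hk] at this
    exact_mod_cast this.symm
  rw [h]
  push_cast
  field_simp
  ring

/-- Two closed sectors between consecutive edges meet only in `0` or along a common edge. -/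
theorem sector_eq {N : ℕ} [NeZero N] {k l : Fin N} {s s' : ℂ} (hs : 0 ≤ s.re) (hs' : 0 ≤ s'.re)
    (h0 : s ≠ 0) (h0' : s' ≠ 0)
    (h : faceCentre N k * s ^ (2 / N : ℂ) = faceCentre N l * s' ^ (2 / N : ℂ)) :
    (k = l ∧ s = s') ∨ (l = k + 1 ∧ ∃ r : ℝ, 0 < r ∧ s = r * I ∧ s' = conj (r * I)) ∨
      (k = l + 1 ∧ ∃ r : ℝ, 0 < r ∧ s' = r * I ∧ s = conj (r * I)) := by
  have hNpos : 0 < N := Nat.pos_of_ne_zero (NeZero.ne N)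
  have hN : (N : ℂ) ≠ 0 := by exact_mod_cast NeZero.ne N
  have hNR : (N : ℝ) ≠ 0 := by exact_mod_cast NeZero.ne N
  rw [cpow_def_of_ne_zero h0, cpow_def_of_ne_zero h0', faceCentre, faceCentre, ← exp_add,
    ← exp_add, exp_eq_exp_iff_exists_int] at h
  obtain ⟨n, hn⟩ := h
  have hn' : log s * 2 + Real.pi * (2 * (k : ℕ) + 3) * I
      = log s' * 2 + (Real.pi * (2 * (l : ℕ) + 3) + 2 * Real.pi * n * N) * I := by
    field_simp at hn
    linear_combination hn
  have hre := congrArg re hn'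
  have him := congrArg im hn'
  simp [log_re, log_im] at hre him
  have hnorm : ‖s‖ = ‖s'‖ :=
    Real.log_injOn_pos (norm_pos_iff.2 h0) (norm_pos_iff.2 h0') hre
  have hpi := Real.pi_pos
  have ha := abs_le.1 (abs_arg_le_pi_div_two_iff.2 hs)
  have ha' := abs_le.1 (abs_arg_le_pi_div_two_iff.2 hs')
  -- `m` counts, with winding, the sectors from `k` to `l`. Comparing arguments gives arg s - arg s'
  -- = πm with both in [-π/2, π/2], so m is -1, 0 or 1, and ±1 occurs only at the endpoints, that
  -- is, on the bounding rays.
  obtain ⟨m, hm⟩ : ∃ m : ℤ, m = (l : ℤ) - k + n * N := ⟨_, rfl⟩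
  have hmR : (m : ℝ) = (l : ℕ) - (k : ℕ) + n * N := by rw [hm]; push_cast; ring
  have harg : s.arg - s'.arg = Real.pi * m := by rw [hmR]; linarith
  have hm1 : m ≤ 1 := by
    have : (m : ℝ) ≤ 1 := by nlinarith
    exact_mod_cast this
  have hm2 : -1 ≤ m := by
    have : (-1 : ℝ) ≤ m := by nlinarith
    exact_mod_cast this
  have hk := k.2
  have hl := l.2
  have hcast : ((l : ℕ) : ZMod N) = (k : ℕ) + (m : ZMod N) := by
    rw [hm]; push_cast; simp
  have key : ∀ a b : Fin N, ((a : ℕ) : ZMod N) = (b : ℕ) + 1 → a = b + 1 := by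
    intro a b hab
    apply Fin.ext
    rw [Fin.val_add, Fin.val_one', Nat.add_mod_mod]
    have : a.1 ≡ b.1 + 1 [MOD N] := (ZMod.natCast_eq_natCast_iff _ _ _).1 (by push_cast; exact hab)
    rw [← this, Nat.mod_eq_of_lt a.2]
  have hIeq : ∀ {x : ℂ}, x.re = 0 → x = (x.im : ℝ) * I := fun hx => by
    apply Complex.ext <;> simp [hx]
  interval_cases m
  · right; right
    have e1 : s.arg = -(Real.pi / 2) := by push_cast at harg; linarith
    have e2 : s'.arg = Real.pi / 2 := by push_cast at harg; linarith
    obtain ⟨r1, i1⟩ := arg_eq_neg_pi_div_two_iff.1 e1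
    obtain ⟨r2, i2⟩ := arg_eq_pi_div_two_iff.1 e2
    refine ⟨key _ _ (by rw [hcast]; push_cast; ring), s'.im, i2, hIeq r2, ?_⟩
    rw [← hIeq r2]
    apply ext_norm_arg
    · rw [norm_conj, hnorm]
    · rw [arg_conj, if_neg, e1, e2]
      rw [e2]; linarith
  · left
    have e : s = s' := ext_norm_arg hnorm (by push_cast at harg; linarith)
    refine ⟨?_, e⟩
    apply Fin.ext
    have : l.1 ≡ k.1 [MOD N] := (ZMod.natCast_eq_natCast_iff _ _ _).1 (by rw [hcast]; simp)
    have := Nat.ModEq.eq_of_lt_of_lt this hl hk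
    exact this.symm
  · right; left
    have e1 : s'.arg = -(Real.pi / 2) := by push_cast at harg; linarith
    have e2 : s.arg = Real.pi / 2 := by push_cast at harg; linarith
    obtain ⟨r1, i1⟩ := arg_eq_neg_pi_div_two_iff.1 e1
    obtain ⟨r2, i2⟩ := arg_eq_pi_div_two_iff.1 e2
    refine ⟨key _ _ (by rw [hcast]; push_cast; ring), s.im, i2, hIeq r2, ?_⟩
    rw [← hIeq r2]
    apply ext_norm_arg
    · rw [norm_conj, hnorm]
    · rw [arg_conj, if_neg, e1, e2]
      rw [e2]; linarith

theorem faceMap_of_ne {N : ℕ} (k : Fin N) {z : ℂ} (hz : z ^ 2 ≠ -1) :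
    faceMap N k z = ((faceCentre N k * cayley (z ^ 2) ^ (2 / N : ℂ) : ℂ) : OnePoint ℂ) := by
  rw [faceMap, if_neg hz, cayley]

theorem faceMap_of_eq {N : ℕ} (k : Fin N) {z : ℂ} (hz : z ^ 2 = -1) :
    faceMap N k z = OnePoint.infty := by
  rw [faceMap, if_pos hz]

theorem norm_sq_le_one {z : ℂ} (hz : ‖z‖ ≤ 1) : ‖z ^ 2‖ ≤ 1 := by
  rw [norm_pow]; exact pow_le_one₀ (norm_nonneg _) hz

theorem two_div_ne_zero (N : ℕ) [NeZero N] : (2 / N : ℂ) ≠ 0 :=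
  div_ne_zero two_ne_zero (by exact_mod_cast NeZero.ne N)

theorem cayley_ne_neg_one (u : ℂ) : cayley u ≠ -1 := by
  intro h
  by_cases hu : 1 + u = 0
  -- At `u = -1` division by zero gives the value 0.
  · simp [cayley, hu] at h
  · rw [cayley, div_eq_iff hu] at h
    have : (2 : ℂ) = 0 := by linear_combination h
    norm_num at this

theorem cayley_eq_zero {u : ℂ} (hu : u ≠ -1) : cayley u = 0 ↔ u = 1 := by
  constructor
  · intro h
    have := cayley_cayley hu
    rw [h] at this
    simpa [cayley] using this.symm
  · rintro rfl; simp [cayley]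

/-- The point `z` of a `k`/`(k+1)` face, on an arc of colour `k + 1`, is identified by `f` with
the point `z'` of a `(k+1)`/`(k+2)` face. -/
def EdgeRel (z z' : ℂ) : Prop := ‖z‖ = 1 ∧ z' ^ 2 = conj z ^ 2 ∧ (z ^ 2).im < 0

/-- `sector_eq` pulled back by z ↦ `cayley (z ^ 2)`. Besides black and white vertices, only points
of equally coloured faces, or of a common coloured edge of adjacent sectors, can have the same
image. Everything is known only up to the sign of z; the vertex labels remove this ambiguity later.
-/
theorem faceMap_eq {N : ℕ} [NeZero N] {k l : Fin N} {z z' : ℂ} (hz : ‖z‖ ≤ 1) (hz' : ‖z'‖ ≤ 1)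
    (h : faceMap N k z = faceMap N l z') :
    (z ^ 2 = -1 ∧ z' ^ 2 = -1) ∨ (z ^ 2 = 1 ∧ z' ^ 2 = 1) ∨ (k = l ∧ z ^ 2 = z' ^ 2) ∨
      (l = k + 1 ∧ EdgeRel z z') ∨ (k = l + 1 ∧ EdgeRel z' z) := by
  by_cases h1 : z ^ 2 = -1
  · by_cases h2 : z' ^ 2 = -1
    · exact Or.inl ⟨h1, h2⟩
    · rw [faceMap_of_eq k h1, faceMap_of_ne l h2] at h
      exact absurd h (OnePoint.infty_ne_coe _)
  by_cases h2 : z' ^ 2 = -1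
  · rw [faceMap_of_ne k h1, faceMap_of_eq l h2] at h
    exact absurd h (OnePoint.coe_ne_infty _)
  right
  rw [faceMap_of_ne k h1, faceMap_of_ne l h2] at h
  replace h := OnePoint.coe_injective h
  have c1 := cayley_cayley h1
  have c2 := cayley_cayley h2
  by_cases h3 : z ^ 2 = 1
  · rw [(cayley_eq_zero h1).2 h3, zero_cpow (two_div_ne_zero N), mul_zero] at h
    have := (mul_eq_zero.1 h.symm).resolve_left (faceCentre_ne_zero N l)
    rw [cpow_eq_zero_iff, cayley_eq_zero h2] at this
    exact Or.inl ⟨h3, this.1⟩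
  by_cases h4 : z' ^ 2 = 1
  · rw [(cayley_eq_zero h2).2 h4, zero_cpow (two_div_ne_zero N), mul_zero] at h
    have := (mul_eq_zero.1 h).resolve_left (faceCentre_ne_zero N k)
    rw [cpow_eq_zero_iff, cayley_eq_zero h1] at this
    exact absurd this.1 h3
  right
  have edge : ∀ {r : ℝ} {a b : ℂ}, 0 < r → a ^ 2 = cayley (r * I) →
      b ^ 2 = cayley (conj (r * I)) → EdgeRel a b := by
    intro r a b hr ha hb
    obtain ⟨n1, i1⟩ := cayley_I_mul hr
    rw [← ha] at n1 i1
    rw [cayley_conj, ← ha] at hb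
    refine ⟨?_, by rw [hb, map_pow], i1⟩
    rw [norm_pow] at n1
    exact (pow_eq_one_iff_of_nonneg (norm_nonneg _) two_ne_zero).1 n1
  rcases sector_eq (cayley_re_nonneg (norm_sq_le_one hz)) (cayley_re_nonneg (norm_sq_le_one hz'))
    (fun hc => h3 ((cayley_eq_zero h1).1 hc)) (fun hc => h4 ((cayley_eq_zero h2).1 hc)) h with
    ⟨e, hs⟩ | ⟨e, r, hr, hs, hs'⟩ | ⟨e, r, hr, hs, hs'⟩
  · exact Or.inl ⟨e, by rw [← c1, ← c2, hs]⟩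
  · exact Or.inr (Or.inl ⟨e, edge hr (by rw [← c1, hs]) (by rw [← c2, hs'])⟩)
  · exact Or.inr (Or.inr ⟨e, edge hr (by rw [← c2, hs]) (by rw [← c1, hs'])⟩)

theorem exists_sector (N : ℕ) [NeZero N] {y : ℂ} (hy : y ≠ 0) :
    ∃ (k : Fin N) (s : ℂ), 0 ≤ s.re ∧ faceCentre N k * s ^ (2 / N : ℂ) = y := by
  have hNpos : 0 < N := Nat.pos_of_ne_zero (NeZero.ne N)
  have hN : (N : ℂ) ≠ 0 := by exact_mod_cast NeZero.ne N
  have hpi := Real.pi_pos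
  -- The sector with central direction π(2n+3)/N consists of the arguments θ with 2n + 2 ≤ Nθ/π ≤ 2n
  -- + 4.
  set n : ℤ := ⌊(N * y.arg / Real.pi - 2) / 2⌋ with hn
  have f1 := Int.floor_le ((N * y.arg / Real.pi - 2) / 2)
  have f2 := Int.lt_floor_add_one ((N * y.arg / Real.pi - 2) / 2)
  rw [← hn] at f1 f2
  have hNZ : (0 : ℤ) < N := by exact_mod_cast hNpos
  have hmod : 0 ≤ n % N := Int.emod_nonneg _ hNZ.ne'
  have hmod' : n % N < N := Int.emod_lt_of_pos _ hNZ
  obtain ⟨k, hk⟩ : ∃ k : Fin N, (k : ℤ) = n % N :=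
    ⟨⟨(n % N).toNat, by omega⟩, by simp [Int.toNat_of_nonneg hmod]⟩
  -- The logarithm of the sought s: solve y = ζ s^(2/N) for log s, with ζ = exp(πi(2n+3)/N).
  set w : ℂ := log y * (N / 2) - Real.pi * I * (2 * n + 3) / 2 with hw
  have hwim : w.im = Real.pi / 2 * (N * y.arg / Real.pi - 2 - 2 * n - 1) := by
    have : w = ((Real.log ‖y‖ * (N / 2) : ℝ) : ℂ)
        + ((y.arg * (N / 2) - Real.pi * (2 * n + 3) / 2 : ℝ) : ℂ) * I := by
      rw [hw, Complex.log]
      push_cast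
      ring
    rw [this, add_im, ofReal_im, im_ofReal_mul, I_im]
    field_simp
    ring
  have w1 : -(Real.pi / 2) ≤ w.im := by rw [hwim]; nlinarith
  have w2 : w.im ≤ Real.pi / 2 := by rw [hwim]; nlinarith
  refine ⟨k, exp w, ?_, ?_⟩
  · rw [exp_re]
    exact mul_nonneg (Real.exp_pos _).le (Real.cos_nonneg_of_mem_Icc ⟨w1, w2⟩)
  · rw [cpow_def_of_ne_zero (exp_ne_zero _), log_exp (by linarith) (by linarith),
      faceCentre_eq_exp N n k hk, ← exp_add]
    conv_rhs => rw [← exp_log hy]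
    congr 1
    rw [hw]
    field_simp
    ring

theorem faceMap_surjective (N : ℕ) [NeZero N] (y : OnePoint ℂ) :
    ∃ (k : Fin N) (z : ℂ), ‖z‖ ≤ 1 ∧ faceMap N k z = y := by
  induction y using OnePoint.rec with
  | infty => exact ⟨0, I, by simp, faceMap_of_eq _ (by simp)⟩
  | coe y =>
    by_cases hy : y = 0
    · refine ⟨0, 1, by simp, ?_⟩
      rw [faceMap_of_ne _ (by norm_num), hy]
      simp [cayley, zero_cpow (two_div_ne_zero N)]
    · obtain ⟨k, s, hs, h⟩ := exists_sector N hy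
      obtain ⟨z, hz⟩ := IsAlgClosed.exists_pow_nat_eq (cayley s) (n := 2) (by norm_num)
      have hs1 : s ≠ -1 := by
        rintro rfl
        norm_num at hs
      refine ⟨k, z, ?_, ?_⟩
      · have := norm_cayley_le hs
        rw [← hz, norm_pow] at this
        exact (pow_le_one_iff_of_nonneg (norm_nonneg _) two_ne_zero).1 this
      · rw [faceMap_of_ne _ (by rw [hz]; exact cayley_ne_neg_one s), hz, cayley_cayley hs1, h]

/-- The N-th power of ζ s^(2/N) is -s², so s = ±1; `cayley` never takes the value -1, and s = 1
means z = 0. -/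
theorem faceMap_mem_faceCentres {N : ℕ} [NeZero N] {k : Fin N} {z : ℂ} (hz : ‖z‖ ≤ 1) :
    faceMap N k z ∈ faceCentres N ↔ z = 0 := by
  have hN : (N : ℂ) ≠ 0 := by exact_mod_cast NeZero.ne N
  constructor
  · rintro ⟨ζ, hζ, h⟩
    by_cases h1 : z ^ 2 = -1
    · rw [faceMap_of_eq k h1] at h
      exact absurd h (OnePoint.infty_ne_coe _)
    rw [faceMap_of_ne k h1] at h
    rw [← OnePoint.coe_injective h, mul_pow, faceCentre_pow, ← cpow_nat_mul] at hζ
    have h2 : (N : ℂ) * (2 / N) = (2 : ℕ) := by push_cast; field_simp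
    rw [h2, cpow_natCast] at hζ
    have h3 : (cayley (z ^ 2) - 1) * (cayley (z ^ 2) - -1) = 0 := by linear_combination -hζ
    rcases mul_eq_zero.1 h3 with h4 | h4
    · have := cayley_cayley h1
      rw [sub_eq_zero.1 h4] at this
      simpa [cayley] using this.symm
    · exact absurd (sub_eq_zero.1 h4) (cayley_ne_neg_one _)
  · rintro rfl
    refine ⟨faceCentre N k, faceCentre_pow N k, ?_⟩
    rw [faceMap_of_ne k (by norm_num)]
    simp [cayley]

theorem continuous_faceMap (N : ℕ) [NeZero N] (k : Fin N) :
    Continuous fun z : Disc => faceMap N k z := by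
  have hNpos : 0 < N := Nat.pos_of_ne_zero (NeZero.ne N)
  have hexp : (2 / N : ℂ) = ((2 / N : ℝ) : ℂ) := by push_cast; ring
  have hexp0 : (0 : ℝ) < 2 / N := by positivity
  rw [continuous_iff_continuousAt]
  intro z
  have hzn : ‖(z : ℂ)‖ ≤ 1 := mem_closedBall_zero_iff.1 z.2
  unfold ContinuousAt
  beta_reduce
  by_cases h1 : (z : ℂ) ^ 2 = -1
  · rw [faceMap_of_eq k h1]
    unfold faceMap
    refine Tendsto.if tendsto_const_nhds ?_
    refine OnePoint.tendsto_coe_infty.comp ?_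
    rw [coclosedCompact_eq_cocompact, ← Metric.cobounded_eq_cocompact,
      ← tendsto_norm_atTop_iff_cobounded]
    simp only [norm_mul, hexp, norm_cpow_real]
    refine Tendsto.const_mul_atTop (norm_pos_iff.2 (faceCentre_ne_zero N k)) ?_
    refine (tendsto_rpow_atTop hexp0).comp ?_
    simp only [norm_div]
    have hnum : Tendsto (fun x : Disc => ‖1 - (x : ℂ) ^ 2‖)
        (𝓝 z ⊓ 𝓟 {x | ¬(x : ℂ) ^ 2 = -1}) (𝓝 2) := by
      have : Continuous fun x : Disc => ‖1 - (x : ℂ) ^ 2‖ := by fun_prop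
      have h := this.tendsto z
      rw [h1] at h
      norm_num at h
      exact h.mono_left inf_le_left
    have hden : Tendsto (fun x : Disc => ‖1 + (x : ℂ) ^ 2‖)
        (𝓝 z ⊓ 𝓟 {x | ¬(x : ℂ) ^ 2 = -1}) (𝓝[>] 0) := by
      have : Continuous fun x : Disc => ‖1 + (x : ℂ) ^ 2‖ := by fun_prop
      have h := this.tendsto z
      rw [h1] at h
      norm_num at h
      refine tendsto_nhdsWithin_iff.2 ⟨h.mono_left inf_le_left, ?_⟩
      refine (eventually_principal.2 fun x hx => ?_).filter_mono inf_le_right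
      refine norm_pos_iff.2 fun h0 => hx ?_
      linear_combination h0
    have := hnum.pos_mul_atTop (by norm_num) (tendsto_inv_nhdsGT_zero.comp hden)
    simpa [div_eq_mul_inv] using this
  · have hev : ∀ᶠ x : Disc in 𝓝 z, faceMap N k x
        = ((faceCentre N k * cayley ((x : ℂ) ^ 2) ^ (2 / N : ℂ) : ℂ) : OnePoint ℂ) := by
      have hc : Continuous fun x : Disc => (x : ℂ) ^ 2 := by fun_prop
      filter_upwards [hc.continuousAt.eventually_ne h1] with x hx
      exact faceMap_of_ne k hx
    rw [faceMap_of_ne k h1]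
    refine Tendsto.congr' (EventuallyEq.symm hev) ?_
    refine (OnePoint.continuous_coe.tendsto _).comp (Tendsto.const_mul _ ?_)
    have hden : 1 + (z : ℂ) ^ 2 ≠ 0 := fun h0 => h1 (by linear_combination h0)
    have hcay : ContinuousAt (fun x : Disc => cayley ((x : ℂ) ^ 2)) z := by
      unfold cayley
      refine ContinuousAt.div ?_ ?_ hden <;> fun_prop
    -- The base stays in the closed right half-plane, which avoids the branch cut; the base 0 is
    -- allowed because the exponent is positive.
    refine (continuousAt_cpow_const_of_re_pos (Or.inl (cayley_re_nonneg (norm_sq_le_one hzn))) ?_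
      ).tendsto.comp hcay
    rw [hexp, ofReal_re]
    exact hexp0

end CubeSurface

/-! ### A criterion for even covering. -/

/-- If `f` is a closed map and `lab` labels part of the domain by a discrete space, with open label
classes, then a base point is evenly covered provided that it has no unlabelled preimage and that
nearby points have exactly one preimage with each label. -/
theorem IsClosedMap.isEvenlyCovered_of_label {X Y D : Type*} [TopologicalSpace X]
    [TopologicalSpace Y] [TopologicalSpace D] [DiscreteTopology D] {f : X → Y}
    (hcl : IsClosedMap f) (hf : Continuous f) {lab : X → Option D}
    (hlab : ∀ d, IsOpen (lab ⁻¹' {some d}))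
    (hlift : ∀ y ∉ f '' (lab ⁻¹' {none}), ∀ d, ∃! x, f x = y ∧ lab x = some d)
    {y : Y} (hy : y ∉ f '' (lab ⁻¹' {none})) : IsEvenlyCovered f y D := by
  set U : Set Y := (f '' (lab ⁻¹' {none}))ᶜ with hUdef
  have hnone : IsClosed (lab ⁻¹' {none}) := by
    have : lab ⁻¹' {none} = (⋃ d, lab ⁻¹' {some d})ᶜ := by
      ext x
      cases h : lab x <;> simp [h]
    rw [this]
    exact (isOpen_iUnion hlab).isClosed_compl
  have hU : IsOpen U := (hcl _ hnone).isOpen_compl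
  have hsome : ∀ x : f ⁻¹' U, ∃ d, lab x = some d := fun x =>
    Option.ne_none_iff_exists'.1 fun h => x.2 ⟨x, h, rfl⟩
  choose lb hlb using hsome
  choose g hg huniq using fun y : U × D => hlift y.1 y.1.2 y.2
  have hgU : ∀ y : U × D, g y ∈ f ⁻¹' U := fun y => by
    rw [Set.mem_preimage, (hg y).1]; exact y.1.2
  refine ⟨inferInstance, U, hy, hU, hU.preimage hf, ?_, ?_⟩
  · refine
      { toFun := fun x => (⟨f x, x.2⟩, lb x)
        invFun := fun y => ⟨g y, hgU y⟩
        left_inv := fun x => Subtype.ext (huniq (⟨f x, x.2⟩, lb x) x ⟨rfl, hlb x⟩).symm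
        right_inv := fun y => ?_
        continuous_toFun := ?_
        continuous_invFun := ?_ }
    · refine Prod.ext (Subtype.ext (hg y).1) (Option.some_injective _ ?_)
      rw [← hlb, (hg y).2]
    · refine Continuous.prodMk (by fun_prop) (continuous_discrete_rng.2 fun d => ?_)
      have : lb ⁻¹' {d} = Subtype.val ⁻¹' (lab ⁻¹' {some d}) := by
        ext x
        simp [hlb]
      rw [this]
      exact (hlab d).preimage continuous_subtype_val
    · refine Continuous.subtype_mk (continuous_prod_of_discrete_right.2 fun d => ?_) _
      refine continuous_iff_isClosed.2 fun C hC => ?_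
      -- Removing the other, open, classes from C leaves a closed set, whose image is closed. The
      -- unlabelled points still in it do no harm: their images lie outside `U`.
      have hC' : IsClosed (C ∩ (⋃ d' ∈ {d' | d' ≠ d}, lab ⁻¹' {some d'})ᶜ) :=
        hC.inter (isOpen_biUnion fun d' _ => hlab d').isClosed_compl
      have : (fun y : U => g (y, d)) ⁻¹' C = Subtype.val ⁻¹'
          (f '' (C ∩ (⋃ d' ∈ {d' | d' ≠ d}, lab ⁻¹' {some d'})ᶜ)) := by
        ext y
        constructor
        · intro h
          refine ⟨g (y, d), ⟨h, ?_⟩, (hg (y, d)).1⟩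
          simp only [Set.mem_compl_iff, Set.mem_iUnion, not_exists]
          intro d' hd' h'
          rw [Set.mem_preimage, (hg (y, d)).2] at h'
          exact hd' (Option.some_injective _ h').symm
        · rintro ⟨x, ⟨hxC, hx⟩, hxy⟩
          have hxU : x ∈ f ⁻¹' U := by rw [Set.mem_preimage, hxy]; exact y.2
          have hd : lb ⟨x, hxU⟩ = d := by
            by_contra hne
            exact hx (Set.mem_biUnion (show lb ⟨x, hxU⟩ ∈ {d' | d' ≠ d} from hne) (hlb ⟨x, hxU⟩))
          rw [Set.mem_preimage, ← huniq (y, d) x ⟨hxy, by rw [← hd]; exact hlb ⟨x, hxU⟩⟩]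
          exact hxC
      rw [this]
      exact (hcl _ hC').preimage continuous_subtype_val
  · exact fun x => rfl

namespace CubeSurface

open Complex Filter Topology

/-! ### Vertices -/

section Vertices

variable {N : ℕ}

/-- Makes the parity of the weight a linear form, so that flips and translations act on it by
addition. -/
theorem natCast_hammingNorm (v : Fin N → ZMod 2) : (hammingNorm v : ZMod 2) = ∑ i, v i := by
  rw [hammingNorm, Finset.card_filter, Nat.cast_sum]
  refine Finset.sum_congr rfl fun i _ => ?_
  generalize v i = a
  revert a
  decide

theorem even_hammingNorm_iff {v : Fin N → ZMod 2} : Even (hammingNorm v) ↔ ∑ i, v i = 0 := by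
  rw [← natCast_hammingNorm, ZMod.natCast_eq_zero_iff_even]

theorem odd_hammingNorm_iff {v : Fin N → ZMod 2} : Odd (hammingNorm v) ↔ ∑ i, v i = 1 := by
  rw [← natCast_hammingNorm, ZMod.natCast_eq_one_iff_odd]

theorem sum_flipAt (k : Fin N) (v : Fin N → ZMod 2) :
    ∑ i, flipAt k v i = (∑ i, v i) + 1 := by
  simp [flipAt, Finset.sum_add_distrib]

theorem flipAt_flipAt (k : Fin N) (v : Fin N → ZMod 2) : flipAt k (flipAt k v) = v := by
  have h : Pi.single k 1 + Pi.single k 1 = (0 : Fin N → ZMod 2) :=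
    funext fun _ => CharTwo.add_self_eq_zero _
  rw [flipAt, flipAt, add_assoc, h, add_zero]

theorem flipAt_comm (k l : Fin N) (v : Fin N → ZMod 2) :
    flipAt k (flipAt l v) = flipAt l (flipAt k v) := by
  simp only [flipAt]
  exact add_right_comm _ _ _

/-- The black end of the edge of colour `k` at a white vertex. -/
def toBlack (k : Fin N) (v : White N) : Black N :=
  ⟨flipAt k v.1, odd_hammingNorm_iff.2 (by
    rw [sum_flipAt, even_hammingNorm_iff.1 v.2, zero_add])⟩

/-- The white end of the edge of colour `k` at a black vertex. -/
def toWhite (k : Fin N) (b : Black N) : White N :=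
  ⟨flipAt k b.1, even_hammingNorm_iff.2 (by
    rw [sum_flipAt, odd_hammingNorm_iff.1 b.2, CharTwo.add_self_eq_zero])⟩

@[simp] theorem toBlack_toWhite (k : Fin N) (b : Black N) : toBlack k (toWhite k b) = b :=
  Subtype.ext (flipAt_flipAt k b.1)

@[simp] theorem toWhite_toBlack (k : Fin N) (v : White N) : toWhite k (toBlack k v) = v :=
  Subtype.ext (flipAt_flipAt k v.1)

/-- The other white vertex of a `k`/`(k+1)` face. -/
def opposite [NeZero N] (k : Fin N) (v : White N) : White N := toWhite (k + 1) (toBlack k v)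

theorem opposite_eq [NeZero N] (k : Fin N) (v : White N) :
    opposite k v = toWhite k (toBlack (k + 1) v) :=
  Subtype.ext (flipAt_comm _ _ _)

@[simp] theorem opposite_opposite [NeZero N] (k : Fin N) (v : White N) :
    opposite k (opposite k v) = v := by
  rw [opposite_eq k (opposite k v), opposite, toBlack_toWhite, toWhite_toBlack]

theorem toBlack_opposite [NeZero N] (k : Fin N) (v : White N) :
    toBlack k (opposite k v) = toBlack (k + 1) v := by
  rw [opposite_eq, toBlack_toWhite]

theorem toBlack_succ_opposite [NeZero N] (k : Fin N) (v : White N) :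
    toBlack (k + 1) (opposite k v) = toBlack k v := by
  rw [opposite, toBlack_toWhite]

/-- The successor is a single cycle on the colours; used to go once around a vertex. -/
theorem eq_of_succ_eq {α : Type*} [NeZero N] {g : Fin N → α} (h : ∀ k, g (k + 1) = g k)
    (k l : Fin N) : g k = g l := by
  have key : ∀ n : ℕ, g (Fin.ofNat N n) = g 0 := by
    intro n
    induction n with
    | zero => rfl
    | succ n ih =>
      refine (congrArg g (Fin.ext ?_)).trans ((h (Fin.ofNat N n)).trans ih)
      simp [Fin.val_add, Fin.ofNat]
  rw [← Fin.ofNat_val_eq_self k, ← Fin.ofNat_val_eq_self l, key, key]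

end Vertices

/-! ### Points of the surface -/

section Points

variable {N : ℕ} [NeZero N]

/-- The point `z` of the `k`/`(k+1)` face seen from `v`. -/
def point (k : Fin N) (v : White N) (z : Disc) : CubeSurface N := Quot.mk _ (k, v, z)

theorem exists_point (x : CubeSurface N) : ∃ k v z, point k v z = x := by
  obtain ⟨⟨k, v, z⟩, rfl⟩ := Quot.exists_rep x
  exact ⟨k, v, z, rfl⟩

theorem coveringMap_point (k : Fin N) (v : White N) (z : Disc) :
    coveringMap N (point k v z) = faceMap N k z := rfl

theorem norm_disc (z : Disc) : ‖(z : ℂ)‖ ≤ 1 := mem_closedBall_zero_iff.1 z.2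

theorem point_turn (k : Fin N) (v : White N) (z z' : Disc) (hz : (z' : ℂ) = -z) :
    point k v z = point k (opposite k v) z' :=
  Quot.sound (Glue.turn k v _ z z' rfl hz)

theorem point_edge (k : Fin N) (v : White N) (z z' : Disc) (hnorm : ‖(z : ℂ)‖ = 1)
    (hre : 0 ≤ (z : ℂ).re) (him : 0 ≤ (z : ℂ).im) (hz : (z' : ℂ) = conj (z : ℂ)) :
    point (k + 1) v z = point k v z' :=
  Quot.sound (Glue.edge k v z z' hnorm hre him hz)

theorem point_one (k l : Fin N) (v : White N) {z : Disc} (hz : (z : ℂ) = 1) :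
    point k v z = point l v z :=
  eq_of_succ_eq (g := fun k => point k v z)
    (fun k => point_edge k v z z (by simp [hz]) (by simp [hz]) (by simp [hz]) (by simp [hz])) k l

/-- Rotation around a black vertex. The white vertex from which the face is seen changes with `k`,
so each step combines an edge gluing, i ↦ -i, with a half turn, -i ↦ i. -/
theorem point_I (k l : Fin N) (b : Black N) {z : Disc} (hz : (z : ℂ) = I) :
    point k (toWhite k b) z = point l (toWhite l b) z := by
  refine eq_of_succ_eq (g := fun k => point k (toWhite k b) z) (fun k => ?_) k l
  have hz' : ((-z : Disc) : ℂ) = -z := rfl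
  rw [point_edge k _ z (-z) (by simp [hz]) (by simp [hz]) (by simp [hz]) (by simp [hz']; simp [hz]),
    point_turn k (toWhite k b) z (-z) hz', opposite, toBlack_toWhite]

theorem coveringMap_continuous : Continuous (coveringMap N) := by
  refine continuous_quot_lift _ ?_
  refine continuous_prod_of_discrete_left.2 fun k => continuous_prod_of_discrete_left.2 fun v => ?_
  exact continuous_faceMap N k

instance : CompactSpace (CubeSurface N) := inferInstanceAs (CompactSpace (Quot (Glue N)))

theorem coveringMap_isClosedMap : IsClosedMap (coveringMap N) := coveringMap_continuous.isClosedMap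

theorem isOpen_preimage_iff {α : Type*} {lab : CubeSurface N → α} {a : α} :
    IsOpen (lab ⁻¹' {a}) ↔ ∀ k v, IsOpen {z : Disc | lab (point k v z) = a} := by
  have h : ∀ S : Set (Fin N × White N × Disc),
      IsOpen S ↔ ∀ k v, IsOpen {z : Disc | (k, v, z) ∈ S} := by
    intro S
    constructor
    · intro hS k v
      exact hS.preimage (by fun_prop : Continuous fun z : Disc => (k, v, z))
    · intro hS
      refine isOpen_iff_mem_nhds.2 fun x hx => ?_
      obtain ⟨k, v, z⟩ := x
      rw [nhds_prod_eq, nhds_prod_eq, nhds_discrete, nhds_discrete, Filter.pure_prod,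
        Filter.pure_prod]
      exact (hS k v).mem_nhds hx
  exact ((isQuotientMap_quot_mk (r := Glue N)).isOpen_preimage (s := lab ⁻¹' {a})).symm.trans (h _)

/-! ### Open stars of the vertices, and the covering property. -/

open Classical in
/-- On the open stars of the white vertices: the white vertex. -/
noncomputable def whiteLabel : CubeSurface N → Option (White N) :=
  Quot.lift (fun x => if 0 < (x.2.2 : ℂ).re then some x.2.1
    else if (x.2.2 : ℂ).re < 0 then some (opposite x.1 x.2.1) else none) (by
    rintro _ _ (⟨k, v, v', z, z', hv, hz⟩ | ⟨k, v, z, z', hnorm, hre, him, hz⟩)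
    · have hv' : v' = opposite k v := Subtype.ext hv
      subst hv'
      have : (z' : ℂ).re = -(z : ℂ).re := by rw [hz, neg_re]
      rcases lt_trichotomy (z : ℂ).re 0 with h | h | h <;> simp [this, h, h.not_gt]
    · have : (z' : ℂ).re = (z : ℂ).re := by rw [hz, conj_re]
      simp [this, hre.not_gt])

open Classical in
/-- On the open stars of the black vertices: the black vertex. -/
noncomputable def blackLabel : CubeSurface N → Option (Black N) :=
  Quot.lift (fun x => if 0 < (x.2.2 : ℂ).im then some (toBlack x.1 x.2.1)
    else if (x.2.2 : ℂ).im < 0 then some (toBlack (x.1 + 1) x.2.1) else none) (by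
    rintro _ _ (⟨k, v, v', z, z', hv, hz⟩ | ⟨k, v, z, z', hnorm, hre, him, hz⟩)
    · have hv' : v' = opposite k v := Subtype.ext hv
      subst hv'
      have : (z' : ℂ).im = -(z : ℂ).im := by rw [hz, neg_im]
      rcases lt_trichotomy (z : ℂ).im 0 with h | h | h <;>
        simp [this, h, h.not_gt, toBlack_opposite, toBlack_succ_opposite]
    · have : (z' : ℂ).im = -(z : ℂ).im := by rw [hz, conj_im]
      rcases him.eq_or_lt with h | h
      · simp [this, ← h]
      · simp [this, h, h.le])

theorem whiteLabel_point (k : Fin N) (v : White N) (z : Disc) :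
    whiteLabel (point k v z) = if 0 < (z : ℂ).re then some v
      else if (z : ℂ).re < 0 then some (opposite k v) else none := rfl

theorem blackLabel_point (k : Fin N) (v : White N) (z : Disc) :
    blackLabel (point k v z) = if 0 < (z : ℂ).im then some (toBlack k v)
      else if (z : ℂ).im < 0 then some (toBlack (k + 1) v) else none := rfl

theorem isOpen_whiteLabel (v : White N) : IsOpen (whiteLabel ⁻¹' {some v}) := by
  refine isOpen_preimage_iff.2 fun k v' => ?_
  have : {z : Disc | whiteLabel (point k v' z) = some v}
      = {z : Disc | 0 < (z : ℂ).re ∧ v' = v} ∪ {z : Disc | (z : ℂ).re < 0 ∧ opposite k v' = v} := by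
    ext z
    rcases lt_trichotomy (z : ℂ).re 0 with h | h | h <;>
      simp [whiteLabel_point, h, h.not_gt]
  have hc : Continuous fun z : Disc => (z : ℂ).re := by fun_prop
  rw [this]
  exact ((isOpen_lt continuous_const hc).and isOpen_const).union
    ((isOpen_lt hc continuous_const).and isOpen_const)

theorem isOpen_blackLabel (b : Black N) : IsOpen (blackLabel ⁻¹' {some b}) := by
  refine isOpen_preimage_iff.2 fun k v' => ?_
  have : {z : Disc | blackLabel (point k v' z) = some b}
      = {z : Disc | 0 < (z : ℂ).im ∧ toBlack k v' = b} ∪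
        {z : Disc | (z : ℂ).im < 0 ∧ toBlack (k + 1) v' = b} := by
    ext z
    rcases lt_trichotomy (z : ℂ).im 0 with h | h | h <;>
      simp [blackLabel_point, h, h.not_gt]
  have hc : Continuous fun z : Disc => (z : ℂ).im := by fun_prop
  rw [this]
  exact ((isOpen_lt continuous_const hc).and isOpen_const).union
    ((isOpen_lt hc continuous_const).and isOpen_const)

/-- Normal form in a star: after a half turn if necessary, the point is seen from `v` with Re z > 0,
and then z² determines z. -/
theorem whiteLabel_eq_some {x : CubeSurface N} {v : White N} :
    whiteLabel x = some v ↔ ∃ (k : Fin N) (z : Disc), 0 < (z : ℂ).re ∧ x = point k v z := by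
  constructor
  · obtain ⟨k, v', z, rfl⟩ := exists_point x
    intro h
    rw [whiteLabel_point] at h
    split_ifs at h with h1 h2
    · exact ⟨k, z, h1, by rw [Option.some_injective _ h]⟩
    · refine ⟨k, -z, by simpa using h2, ?_⟩
      rw [← Option.some_injective _ h]
      exact point_turn k v' z (-z) rfl
  · rintro ⟨k, z, hz, rfl⟩
    rw [whiteLabel_point, if_pos hz]

theorem blackLabel_eq_some {x : CubeSurface N} {b : Black N} :
    blackLabel x = some b ↔ ∃ (k : Fin N) (z : Disc), 0 < (z : ℂ).im ∧ x = point k (toWhite k b) z := by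
  constructor
  · obtain ⟨k, v', z, rfl⟩ := exists_point x
    intro h
    rw [blackLabel_point] at h
    split_ifs at h with h1 h2
    · exact ⟨k, z, h1, by rw [← Option.some_injective _ h, toWhite_toBlack]⟩
    · refine ⟨k, -z, by simpa using h2, ?_⟩
      rw [← Option.some_injective _ h, ← opposite_eq]
      exact point_turn k v' z (-z) rfl
  · rintro ⟨k, z, hz, rfl⟩
    rw [blackLabel_point, if_pos hz, toBlack_toWhite]

theorem eq_of_sq_eq_of_re_pos {z w : ℂ} (h : z ^ 2 = w ^ 2) (hz : 0 < z.re) (hw : 0 < w.re) :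
    z = w := by
  refine (sq_eq_sq_iff_eq_or_eq_neg.1 h).resolve_right fun h' => ?_
  rw [h', neg_re] at hz
  linarith

theorem eq_of_sq_eq_of_im_pos {z w : ℂ} (h : z ^ 2 = w ^ 2) (hz : 0 < z.im) (hw : 0 < w.im) :
    z = w := by
  refine (sq_eq_sq_iff_eq_or_eq_neg.1 h).resolve_right fun h' => ?_
  rw [h', neg_im] at hz
  linarith

theorem re_eq_zero_of_sq {z : ℂ} (h : z ^ 2 = -1) : z.re = 0 := by
  rw [← I_sq] at h
  rcases sq_eq_sq_iff_eq_or_eq_neg.1 h with h | h <;> simp [h]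

theorem im_eq_zero_of_sq {z : ℂ} (h : z ^ 2 = 1) : z.im = 0 := by
  rcases sq_eq_sq_iff_eq_or_eq_neg.1 (h.trans (one_pow 2).symm) with h | h <;> simp [h]

theorem im_sq (z : ℂ) : (z ^ 2).im = 2 * (z.re * z.im) := by
  rw [sq, mul_im]; ring

theorem point_eq_of_edgeRel_re {k : Fin N} {v : White N} {z z' : Disc} (h : EdgeRel z z')
    (hz : 0 < (z : ℂ).re) (hz' : 0 < (z' : ℂ).re) : point k v z = point (k + 1) v z' := by
  obtain ⟨hn, hsq, him⟩ := h
  have e : (z' : ℂ) = conj (z : ℂ) := eq_of_sq_eq_of_re_pos hsq hz' (by simpa using hz)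
  rw [im_sq] at him
  refine (point_edge k v z' z (by rw [e, norm_conj, hn]) hz'.le ?_ (by rw [e, conj_conj])).symm
  rw [e, conj_im]
  nlinarith

theorem point_eq_of_edgeRel_im {k : Fin N} {b : Black N} {z z' : Disc} (h : EdgeRel z z')
    (hz : 0 < (z : ℂ).im) (hz' : 0 < (z' : ℂ).im) :
    point k (toWhite k b) z = point (k + 1) (toWhite (k + 1) b) z' := by
  obtain ⟨hn, hsq, him⟩ := h
  have e : (z' : ℂ) = -conj (z : ℂ) :=
    eq_of_sq_eq_of_im_pos (by rw [hsq, neg_sq]) hz' (by simpa using hz)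
  rw [im_sq] at him
  rw [point_turn k _ z (-z) rfl, opposite, toBlack_toWhite]
  refine (point_edge k _ z' (-z) (by rw [e, norm_neg, norm_conj, hn]) ?_ hz'.le ?_).symm
  · rw [e, neg_re, conj_re]
    nlinarith
  · rw [e, map_neg, conj_conj]
    rfl

/-- Existence: keep the face colours and ±z of any preimage in a face and replace the white vertex
by `v`. Uniqueness: in normal form the cases of `faceMap_eq` are exactly the gluings around `v`. -/
theorem existsUnique_whiteLabel {y : OnePoint ℂ}
    (hy : y ∉ coveringMap N '' (whiteLabel ⁻¹' {none})) (v : White N) :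
    ∃! x, coveringMap N x = y ∧ whiteLabel x = some v := by
  refine existsUnique_of_exists_of_unique ?_ ?_
  · obtain ⟨k, z, hz, rfl⟩ := faceMap_surjective N y
    lift z to Disc using mem_closedBall_zero_iff.2 hz
    rcases lt_trichotomy (z : ℂ).re 0 with h | h | h
    · exact ⟨point k v (-z), faceMap_neg N k z,
        whiteLabel_eq_some.2 ⟨k, -z, by simpa using h, rfl⟩⟩
    · exact absurd ⟨point k v z, by simp [whiteLabel_point, h], rfl⟩ hy
    · exact ⟨point k v z, rfl, whiteLabel_eq_some.2 ⟨k, z, h, rfl⟩⟩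
  · rintro x x' ⟨hx, hv⟩ ⟨hx', hv'⟩
    obtain ⟨k, z, hz, rfl⟩ := whiteLabel_eq_some.1 hv
    obtain ⟨l, z', hz', rfl⟩ := whiteLabel_eq_some.1 hv'
    rw [← hx', coveringMap_point, coveringMap_point] at hx
    rcases faceMap_eq (norm_disc z) (norm_disc z') hx with
      ⟨h, -⟩ | ⟨h, h'⟩ | ⟨rfl, h⟩ | ⟨rfl, h⟩ | ⟨rfl, h⟩
    · exact absurd (re_eq_zero_of_sq h) hz.ne'
    · have e := eq_of_sq_eq_of_re_pos (h.trans (one_pow 2).symm) hz (by simp)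
      have e' := eq_of_sq_eq_of_re_pos (h'.trans (one_pow 2).symm) hz' (by simp)
      rw [Subtype.ext (e'.trans e.symm)]
      exact point_one k l v e
    · rw [Subtype.ext (eq_of_sq_eq_of_re_pos h hz hz')]
    · exact point_eq_of_edgeRel_re h hz hz'
    · exact (point_eq_of_edgeRel_re h hz' hz).symm

theorem existsUnique_blackLabel {y : OnePoint ℂ}
    (hy : y ∉ coveringMap N '' (blackLabel ⁻¹' {none})) (b : Black N) :
    ∃! x, coveringMap N x = y ∧ blackLabel x = some b := by
  refine existsUnique_of_exists_of_unique ?_ ?_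
  · obtain ⟨k, z, hz, rfl⟩ := faceMap_surjective N y
    lift z to Disc using mem_closedBall_zero_iff.2 hz
    rcases lt_trichotomy (z : ℂ).im 0 with h | h | h
    · exact ⟨point k (toWhite k b) (-z), faceMap_neg N k z,
        blackLabel_eq_some.2 ⟨k, -z, by simpa using h, rfl⟩⟩
    · exact absurd ⟨point k (toWhite k b) z, by simp [blackLabel_point, h], rfl⟩ hy
    · exact ⟨point k (toWhite k b) z, rfl, blackLabel_eq_some.2 ⟨k, z, h, rfl⟩⟩
  · rintro x x' ⟨hx, hv⟩ ⟨hx', hv'⟩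
    obtain ⟨k, z, hz, rfl⟩ := blackLabel_eq_some.1 hv
    obtain ⟨l, z', hz', rfl⟩ := blackLabel_eq_some.1 hv'
    rw [← hx', coveringMap_point, coveringMap_point] at hx
    rcases faceMap_eq (norm_disc z) (norm_disc z') hx with
      ⟨h, h'⟩ | ⟨h, -⟩ | ⟨rfl, h⟩ | ⟨rfl, h⟩ | ⟨rfl, h⟩
    · have e := eq_of_sq_eq_of_im_pos (h.trans I_sq.symm) hz (by simp)
      have e' := eq_of_sq_eq_of_im_pos (h'.trans I_sq.symm) hz' (by simp)
      rw [Subtype.ext (e'.trans e.symm)]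
      exact point_I k l b e
    · exact absurd (im_eq_zero_of_sq h) hz.ne'
    · rw [Subtype.ext (eq_of_sq_eq_of_im_pos h hz hz')]
    · exact point_eq_of_edgeRel_im h hz hz'
    · exact (point_eq_of_edgeRel_im h hz' hz).symm

theorem isEvenlyCovered_white {y : OnePoint ℂ}
    (hy : y ∉ coveringMap N '' (whiteLabel ⁻¹' {none})) :
    IsEvenlyCovered (coveringMap N) y (White N) :=
  coveringMap_isClosedMap.isEvenlyCovered_of_label coveringMap_continuous isOpen_whiteLabel
    (fun _ hy => existsUnique_whiteLabel hy) hy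

theorem isEvenlyCovered_black {y : OnePoint ℂ}
    (hy : y ∉ coveringMap N '' (blackLabel ⁻¹' {none})) :
    IsEvenlyCovered (coveringMap N) y (Black N) :=
  coveringMap_isClosedMap.isEvenlyCovered_of_label coveringMap_continuous isOpen_blackLabel
    (fun _ hy => existsUnique_blackLabel hy) hy

theorem re_eq_zero_of_whiteLabel {k : Fin N} {v : White N} {z : Disc}
    (h : whiteLabel (point k v z) = none) : (z : ℂ).re = 0 := by
  rw [whiteLabel_point] at h
  split_ifs at h with h1 h2
  linarith

theorem im_eq_zero_of_blackLabel {k : Fin N} {v : White N} {z : Disc}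
    (h : blackLabel (point k v z) = none) : (z : ℂ).im = 0 := by
  rw [blackLabel_point] at h
  split_ifs at h with h1 h2
  linarith

/-- Points without white label have z² ≤ 0, those without black label z² ≥ 0; neither lies on an
open edge. A common image therefore forces z = 0, a face centre. -/
theorem notMem_or_notMem_of_notMem_faceCentres {y : OnePoint ℂ} (hy : y ∉ faceCentres N) :
    y ∉ coveringMap N '' (whiteLabel ⁻¹' {none}) ∨
      y ∉ coveringMap N '' (blackLabel ⁻¹' {none}) := by
  by_contra! hcon
  obtain ⟨⟨x, hx, hxy⟩, x', hx', hxy'⟩ := hcon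
  obtain ⟨k, v, z, rfl⟩ := exists_point x
  obtain ⟨l, v', z', rfl⟩ := exists_point x'
  have hz := re_eq_zero_of_whiteLabel hx
  have hz' := im_eq_zero_of_blackLabel hx'
  have e : ((z : ℂ) ^ 2).re = -((z : ℂ).im ^ 2) := by rw [sq, mul_re, hz]; ring
  have e' : ((z' : ℂ) ^ 2).re = (z' : ℂ).re ^ 2 := by rw [sq, mul_re, hz']; ring
  rw [coveringMap_point] at hxy hxy'
  have him : ∀ w : ℂ, w.re = 0 ∨ w.im = 0 → ¬(w ^ 2).im < 0 := by
    rintro w (h | h) <;> simp [im_sq, h]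
  rcases faceMap_eq (norm_disc z) (norm_disc z') (hxy.trans hxy'.symm) with
    ⟨-, h⟩ | ⟨h, -⟩ | ⟨-, h⟩ | ⟨-, h⟩ | ⟨-, h⟩
  · rw [h] at e'
    norm_num at e'
    nlinarith
  · rw [h] at e
    norm_num at e
    nlinarith
  · rw [h, e'] at e
    have h0 : (z' : ℂ) = 0 := by
      apply Complex.ext
      · rw [zero_re]; nlinarith
      · simpa using hz'
    exact hy (hxy' ▸ (faceMap_mem_faceCentres (norm_disc z')).2 h0)
  · exact him _ (Or.inl hz) h.2.2
  · exact him _ (Or.inr hz') h.2.2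

theorem isCoveringMapOn_coveringMap : IsCoveringMapOn (coveringMap N) (faceCentres N)ᶜ := by
  intro y hy
  rcases notMem_or_notMem_of_notMem_faceCentres hy with h | h
  · exact (isEvenlyCovered_white h).to_isEvenlyCovered_preimage
  · exact (isEvenlyCovered_black h).to_isEvenlyCovered_preimage

theorem isCoveringMap_unramifiedMap : IsCoveringMap (unramifiedMap N) :=
  isCoveringMapOn_coveringMap.isCoveringMap_restrictPreimage _

theorem card_fibre {n : ℕ} (hw : Nat.card (White N) = n) (hb : Nat.card (Black N) = n)
    {y : OnePoint ℂ} (hy : y ∉ faceCentres N) : Nat.card (coveringMap N ⁻¹' {y}) = n := by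
  rcases notMem_or_notMem_of_notMem_faceCentres hy with h | h
  · rw [← hw]
    exact Nat.card_congr (isEvenlyCovered_white h).fiberHomeomorph.toEquiv.symm
  · rw [← hb]
    exact Nat.card_congr (isEvenlyCovered_black h).fiberHomeomorph.toEquiv.symm

theorem coveringMap_eq_zero_iff {x : CubeSurface N} :
    coveringMap N x = ((0 : ℂ) : OnePoint ℂ) ↔ ∃ v, x = whitePoint v := by
  have h0 : ∀ v : White N, coveringMap N (whitePoint v) = ((0 : ℂ) : OnePoint ℂ) := by
    intro v
    change faceMap N 0 1 = _
    rw [faceMap_of_ne _ (by norm_num)]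
    simp [cayley, zero_cpow (two_div_ne_zero N)]
  constructor
  · intro hx
    obtain ⟨k, v, z, rfl⟩ := exists_point x
    rw [← h0 v, whitePoint, ← point, coveringMap_point, coveringMap_point] at hx
    have h1 : (z : ℂ) ^ 2 = 1 := by
      rcases faceMap_eq (norm_disc z) (by simp) hx with
        ⟨-, h⟩ | ⟨h, -⟩ | ⟨-, h⟩ | ⟨-, h⟩ | ⟨-, h⟩
      · norm_num at h
      · exact h
      · simpa using h
      · have h2 := congrArg conj h.2.1
        rw [map_pow, map_pow, conj_conj] at h2
        rw [← h2]
        simp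
      · have := h.2.2
        simp at this
    rcases sq_eq_sq_iff_eq_or_eq_neg.1 (h1.trans (one_pow 2).symm) with h | h
    · refine ⟨v, ?_⟩
      have h2 : z = ⟨1, by simp⟩ := Subtype.ext h
      rw [point_one k 0 v h, h2]
      rfl
    · refine ⟨opposite k v, ?_⟩
      have h' : ((-z : Disc) : ℂ) = 1 := (congrArg Neg.neg h).trans (neg_neg 1)
      have h2 : -z = ⟨1, by simp⟩ := Subtype.ext h'
      rw [point_turn k v z (-z) rfl, point_one k 0 _ h', h2]
      rfl
  · rintro ⟨v, rfl⟩
    exact h0 v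

theorem whiteLabel_whitePoint (v : White N) : whiteLabel (whitePoint v) = some v :=
  whiteLabel_eq_some.2 ⟨0, _, by simp, rfl⟩

theorem whitePoint_injective : Function.Injective (whitePoint (N := N)) := fun v v' h => by
  have := congrArg whiteLabel h
  rwa [whiteLabel_whitePoint, whiteLabel_whitePoint, Option.some_inj] at this

/-- The fibre over `0` is the set of white vertices. -/
noncomputable def whiteFibre : White N ≃ unramifiedMap N ⁻¹' {basePoint N} :=
  Equiv.ofBijective
    (fun v => ⟨⟨whitePoint v, by
        rw [Set.mem_preimage, coveringMap_eq_zero_iff.2 ⟨v, rfl⟩]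
        exact (basePoint N).2⟩, Subtype.ext (coveringMap_eq_zero_iff.2 ⟨v, rfl⟩)⟩)
    ⟨fun v v' h => whitePoint_injective (congrArg (fun x => x.1.1) h), fun x => by
      obtain ⟨v, hv⟩ := coveringMap_eq_zero_iff.1 (congrArg Subtype.val x.2)
      exact ⟨v, Subtype.ext (Subtype.ext hv.symm)⟩⟩

theorem coe_whiteFibre (v : White N) :
    ((whiteFibre v : PuncturedSurface N) : CubeSurface N) = whitePoint v := rfl

end Points

end CubeSurface

/-! ### Monodromy, deck transformations and lifts. -/

/-- Monodromy commutes with deck transformations. -/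
theorem IsCoveringMap.monodromy_deck {E X : Type*} [TopologicalSpace E] [TopologicalSpace X]
    {p : E → X} (cov : IsCoveringMap p) (D : C(E, E)) (hD : ∀ e, p (D e) = p e) {x y : X}
    (γ : Path.Homotopic.Quotient x y) {e e' : p ⁻¹' {x}} (he : (e' : E) = D e) :
    (cov.monodromy γ e' : E) = D (cov.monodromy γ e) := by
  obtain ⟨γ⟩ := γ
  -- The image under `D` of the lift at `e` lifts the same path and starts at `e'`; lifts are
  -- unique.
  have h : D.comp (cov.liftPath γ e (γ.source.trans e.2.symm))
      = cov.liftPath γ e' (γ.source.trans e'.2.symm) := by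
    refine (cov.eq_liftPath_iff' _).2 ⟨funext fun t => ?_, ?_⟩
    · exact (hD _).trans (congrFun (cov.liftPath_lifts γ e (γ.source.trans e.2.symm)) t)
    · rw [he]
      exact congrArg D (cov.liftPath_zero γ e (γ.source.trans e.2.symm))
  exact (congrArg (fun Γ : C(unitInterval, E) => Γ 1) h).symm

/-- The monodromy along a path can be read off from a lift. -/
theorem IsCoveringMap.monodromy_mk_eq {E X : Type*} [TopologicalSpace E] [TopologicalSpace X]
    {p : E → X} (cov : IsCoveringMap p) {x y : X} (γ : Path x y) {e : p ⁻¹' {x}} {e' : p ⁻¹' {y}}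
    (Γ : C(unitInterval, E)) (hΓ : ∀ t, p (Γ t) = γ t) (h0 : Γ 0 = e) (h1 : Γ 1 = e') :
    cov.monodromy (Path.Homotopic.Quotient.mk γ) e = e' := by
  have h : Γ = cov.liftPath γ e (γ.source.trans e.2.symm) :=
    (cov.eq_liftPath_iff' _).2 ⟨funext hΓ, h0⟩
  refine Subtype.ext ?_
  rw [← h1, h]
  rfl

namespace CubeSurface

open Complex Filter Topology

/-! ### Translations as deck transformations. -/

section Deck

variable {N : ℕ} [NeZero N]

/-- Translation of the white vertices by an even vector. -/
def translate (a v : White N) : White N :=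
  ⟨v.1 + a.1, even_hammingNorm_iff.2 (by
    simp only [Pi.add_apply, Finset.sum_add_distrib]
    rw [even_hammingNorm_iff.1 v.2, even_hammingNorm_iff.1 a.2, add_zero])⟩

omit [NeZero N] in
theorem flipAt_add (k : Fin N) (v a : Fin N → ZMod 2) : flipAt k (v + a) = flipAt k v + a :=
  add_right_comm _ _ _

theorem opposite_translate (k : Fin N) (a v : White N) :
    opposite k (translate a v) = translate a (opposite k v) := by
  refine Subtype.ext ?_
  change flipAt (k + 1) (flipAt k (v.1 + a.1)) = flipAt (k + 1) (flipAt k v.1) + a.1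
  rw [flipAt_add, flipAt_add]

/-- The deck transformation of `f` that translates the vertices by `a`. -/
def deck (a : White N) : CubeSurface N → CubeSurface N :=
  Quot.map (fun x => (x.1, translate a x.2.1, x.2.2)) (by
    rintro _ _ (⟨k, v, v', z, z', hv, hz⟩ | ⟨k, v, z, z', hnorm, hre, him, hz⟩)
    · have hv' : v' = opposite k v := Subtype.ext hv
      subst hv'
      exact Glue.turn k _ _ z z' (congrArg Subtype.val (opposite_translate k a v)).symm hz
    · exact Glue.edge k _ z z' hnorm hre him hz)

theorem continuous_deck (a : White N) : Continuous (deck a) := by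
  have hc : Continuous fun x : Fin N × White N × Disc => (x.1, translate a x.2.1, x.2.2) :=
    continuous_fst.prodMk (((continuous_of_discreteTopology (f := translate a)).comp
      (continuous_fst.comp continuous_snd)).prodMk (continuous_snd.comp continuous_snd))
  exact continuous_quot_lift _ (continuous_quot_mk.comp hc)

theorem coveringMap_deck (a : White N) (x : CubeSurface N) :
    coveringMap N (deck a x) = coveringMap N x := by
  obtain ⟨k, v, z, rfl⟩ := exists_point x
  rfl

/-- The deck transformation away from the centres of the faces. -/
def puncturedDeck (a : White N) : C(PuncturedSurface N, PuncturedSurface N) where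
  toFun x := ⟨deck a x, (Set.mem_preimage.trans (by rw [coveringMap_deck]; rfl)).2 x.2⟩
  continuous_toFun := ((continuous_deck a).comp continuous_subtype_val).subtype_mk _

theorem unramifiedMap_puncturedDeck (a : White N) (x : PuncturedSurface N) :
    unramifiedMap N (puncturedDeck a x) = unramifiedMap N x :=
  Subtype.ext (coveringMap_deck a x)

theorem puncturedDeck_whiteFibre (a v : White N) :
    puncturedDeck a (whiteFibre v) = whiteFibre (translate a v) := rfl

/-- The monodromy permutations of the white vertices are translations. -/
theorem exists_monodromy_eq_translate (hf : IsCoveringMap (unramifiedMap N))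
    (γ : Path.Homotopic.Quotient (basePoint N) (basePoint N)) :
    ∃ a, ∀ v, hf.monodromy γ (whiteFibre v) = whiteFibre (translate a v) := by
  -- Translation by v carries the zero vertex to v, so the image a of the zero vertex determines the
  -- permutation: v goes to a + v.
  set o : White N := ⟨0, by simp⟩ with ho
  obtain ⟨a, ha⟩ := whiteFibre.surjective (hf.monodromy γ (whiteFibre o))
  refine ⟨a, fun v => Subtype.ext ?_⟩
  have hv : translate v o = v := Subtype.ext (zero_add _)
  have hva : translate v a = translate a v := Subtype.ext (add_comm _ _)
  have h := hf.monodromy_deck (puncturedDeck v) (unramifiedMap_puncturedDeck v) γ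
    (e := whiteFibre o) (e' := whiteFibre v) (by rw [puncturedDeck_whiteFibre, hv])
  rw [h, ← ha, puncturedDeck_whiteFibre, hva]

end Deck

/-! ### Lifting the loop around a face centre. -/

section Loops

/-- The square root of `u` with nonnegative imaginary part, provided that `ε = ±1` is the sign of
the imaginary part of `u`. -/
noncomputable def halfAngle (ε : ℝ) (u : ℂ) : ℂ :=
  (ε * √((‖u‖ + u.re) / 2) : ℝ) + (√((‖u‖ - u.re) / 2) : ℝ) * I

theorem halfAngle_sq {ε : ℝ} {u : ℂ} (hε : ε ^ 2 = 1) (hu : 0 ≤ ε * u.im) :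
    halfAngle ε u ^ 2 = u := by
  have h1 : 0 ≤ (‖u‖ + u.re) / 2 := by
    have := neg_le_of_abs_le (abs_re_le_norm u); linarith
  have h2 : 0 ≤ (‖u‖ - u.re) / 2 := by
    have := re_le_norm u; linarith
  -- The product is |Im u|/2, and the sign hypothesis identifies |Im u| with ε Im u.
  have h3 : √((‖u‖ + u.re) / 2) * √((‖u‖ - u.re) / 2) = ε * u.im / 2 := by
    rw [← Real.sqrt_mul h1, Real.sqrt_eq_iff_eq_sq (mul_nonneg h1 h2) (by linarith)]
    have h4 : ‖u‖ ^ 2 = u.re * u.re + u.im * u.im := by rw [← normSq_eq_norm_sq, normSq_apply]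
    linear_combination (1 / 4) * h4 - (u.im ^ 2 / 4) * hε
  have h1' := Real.sq_sqrt h1
  have h2' := Real.sq_sqrt h2
  rw [halfAngle, sq]
  generalize √((‖u‖ + u.re) / 2) = a at *
  generalize √((‖u‖ - u.re) / 2) = b at *
  apply Complex.ext
  · simp
    linear_combination a ^ 2 * hε + h1' - h2'
  · simp
    linear_combination 2 * ε * h3 + u.im * hε

/-- The loop `s` that becomes `faceLoop` under `s ↦ faceCentre N k * s ^ (2 / N)`. -/
noncomputable def circleLoop (t : ℝ) : ℂ := (3 / 2) * (1 - exp (2 * Real.pi * I * t))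

theorem circleLoop_eq (t : ℝ) : circleLoop t
    = ((3 / 2 * (1 - Real.cos (2 * Real.pi * t)) : ℝ) : ℂ)
      + ((-(3 / 2) * Real.sin (2 * Real.pi * t) : ℝ) : ℂ) * I := by
  have h : (2 * Real.pi * I * t : ℂ) = ((2 * Real.pi * t : ℝ) : ℂ) * I := by push_cast; ring
  rw [circleLoop, h, exp_mul_I, ← ofReal_cos, ← ofReal_sin]
  push_cast
  ring

theorem circleLoop_re (t : ℝ) : (circleLoop t).re = 3 / 2 * (1 - Real.cos (2 * Real.pi * t)) := by
  rw [circleLoop_eq, add_re, ofReal_re, re_ofReal_mul, I_re, mul_zero, add_zero]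

theorem circleLoop_im (t : ℝ) : (circleLoop t).im = -(3 / 2) * Real.sin (2 * Real.pi * t) := by
  rw [circleLoop_eq, add_im, ofReal_im, im_ofReal_mul, I_im, mul_one, zero_add]

theorem circleLoop_re_nonneg (t : ℝ) : 0 ≤ (circleLoop t).re := by
  rw [circleLoop_re]
  have := Real.cos_le_one (2 * Real.pi * t)
  linarith

theorem circleLoop_ne_neg_one (t : ℝ) : circleLoop t ≠ -1 := by
  intro h
  have := circleLoop_re_nonneg t
  rw [h] at this
  norm_num at this

theorem circleLoop_ne_one (t : ℝ) : circleLoop t ≠ 1 := by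
  intro h
  have h1 := circleLoop_re t
  have h2 := circleLoop_im t
  rw [h] at h1 h2
  simp at h1 h2
  have h3 := Real.sin_sq_add_cos_sq (2 * Real.pi * t)
  rw [h2] at h3
  nlinarith

theorem cayley_im (s : ℂ) : (cayley s).im = -(2 * s.im) / normSq (1 + s) := by
  rw [cayley, div_im]
  simp only [sub_re, one_re, add_re, sub_im, one_im, add_im]
  ring

/-- A lift of `circleLoop` to a face. -/
noncomputable def rootLoop (t : ℝ) : ℂ :=
  halfAngle (if t ≤ 1 / 2 then 1 else -1) (cayley (circleLoop t))

theorem rootLoop_sq {t : ℝ} (h0 : 0 ≤ t) (h1 : t ≤ 1) :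
    rootLoop t ^ 2 = cayley (circleLoop t) := by
  have hpi := Real.pi_pos
  refine halfAngle_sq (by split_ifs <;> norm_num) ?_
  have him : (cayley (circleLoop t)).im
      = 3 * Real.sin (2 * Real.pi * t) / normSq (1 + circleLoop t) := by
    rw [cayley_im, circleLoop_im]; ring
  rw [him]
  split_ifs with h
  · rw [one_mul]
    refine div_nonneg (mul_nonneg (by norm_num) ?_) (normSq_nonneg _)
    exact Real.sin_nonneg_of_nonneg_of_le_pi (by positivity) (by nlinarith)
  · rw [neg_one_mul, neg_nonneg]
    refine div_nonpos_of_nonpos_of_nonneg ?_ (normSq_nonneg _)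
    have h2 : Real.sin (2 * Real.pi * t) = -Real.sin (2 * Real.pi * t - Real.pi) := by
      rw [Real.sin_sub_pi, neg_neg]
    rw [h2]
    have := Real.sin_nonneg_of_nonneg_of_le_pi (x := 2 * Real.pi * t - Real.pi)
      (by nlinarith) (by nlinarith)
    linarith

/-- The branches change at t = 1/2, where `circleLoop` is 3 and its Cayley image is -1/2. The roots
of a negative number are imaginary, so both signs ε give the same value there. -/
theorem continuous_rootLoop : Continuous rootLoop := by
  have hs : Continuous circleLoop := by unfold circleLoop; fun_prop
  have hu : Continuous fun t => cayley (circleLoop t) := by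
    unfold cayley
    refine Continuous.div (by fun_prop) (by fun_prop) fun t h => circleLoop_ne_neg_one t ?_
    linear_combination h
  have h2 : ∀ ε : ℝ, Continuous fun t => halfAngle ε (cayley (circleLoop t)) := by
    intro ε
    unfold halfAngle
    fun_prop
  have : rootLoop = fun t => if t ≤ 1 / 2 then halfAngle 1 (cayley (circleLoop t))
      else halfAngle (-1) (cayley (circleLoop t)) := by
    funext t
    rw [rootLoop]
    split_ifs <;> rfl
  rw [this]
  refine Continuous.if_le (h2 1) (h2 (-1)) continuous_id continuous_const ?_
  intro t ht
  have ht' : t = 1 / 2 := ht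
  have h3 : circleLoop t = 3 := by
    have h4 : (2 * Real.pi * I * ((1 / 2 : ℝ) : ℂ) : ℂ) = Real.pi * I := by push_cast; ring
    rw [ht', circleLoop, h4, exp_pi_mul_I]
    norm_num
  have h5 : cayley 3 = ((-(1 / 2) : ℝ) : ℂ) := by
    rw [cayley]; push_cast; norm_num
  rw [h3, h5, halfAngle, halfAngle, norm_real, ofReal_re]
  norm_num

theorem norm_rootLoop_le {t : ℝ} (h0 : 0 ≤ t) (h1 : t ≤ 1) : ‖rootLoop t‖ ≤ 1 := by
  have := norm_cayley_le (circleLoop_re_nonneg t)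
  rw [← rootLoop_sq h0 h1, norm_pow] at this
  exact (pow_le_one_iff_of_nonneg (norm_nonneg _) two_ne_zero).1 this

theorem rootLoop_ne_zero {t : ℝ} (h0 : 0 ≤ t) (h1 : t ≤ 1) : rootLoop t ≠ 0 := by
  intro h
  have h2 := rootLoop_sq h0 h1
  rw [h, zero_pow two_ne_zero] at h2
  have h3 := cayley_cayley (circleLoop_ne_neg_one t)
  rw [← h2] at h3
  refine circleLoop_ne_one t (h3.symm.trans ?_)
  simp [cayley]

theorem rootLoop_zero : rootLoop 0 = 1 := by
  simp [rootLoop, circleLoop, cayley, halfAngle]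

/-- The square returns to 1 after one turn around 0, but the root, kept in the closed upper
half-plane, ends at -1: this is the exchange of the two white vertices. -/
theorem rootLoop_one : rootLoop 1 = -1 := by
  have h : ¬(1 : ℝ) ≤ 1 / 2 := by norm_num
  rw [rootLoop, if_neg h]
  simp [circleLoop, cayley, halfAngle]

variable {N : ℕ} [NeZero N]

omit [NeZero N] in
theorem faceMap_rootLoop (k : Fin N) {t : ℝ} (h0 : 0 ≤ t) (h1 : t ≤ 1) :
    faceMap N k (rootLoop t) = (faceLoop N k t : ℂ) := by
  have h := rootLoop_sq h0 h1
  rw [faceMap_of_ne k (by rw [h]; exact cayley_ne_neg_one _), h,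
    cayley_cayley (circleLoop_ne_neg_one t)]
  rfl

/-- The lift of `faceLoop` that starts at a white vertex of a face. -/
noncomputable def faceLoopLift (k : Fin N) (v : White N) :
    C(unitInterval, PuncturedSurface N) where
  toFun t := ⟨point k v ⟨rootLoop t, mem_closedBall_zero_iff.2 (norm_rootLoop_le t.2.1 t.2.2)⟩, by
    rw [Set.mem_preimage, coveringMap_point, Set.mem_compl_iff,
      faceMap_mem_faceCentres (norm_rootLoop_le t.2.1 t.2.2)]
    exact rootLoop_ne_zero t.2.1 t.2.2⟩
  continuous_toFun := by
    have h : Continuous fun z : Disc => point k v z :=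
      continuous_quot_mk.comp (by fun_prop : Continuous fun z : Disc => (k, v, z))
    exact (h.comp ((continuous_rootLoop.comp continuous_subtype_val).subtype_mk _)).subtype_mk _

theorem coe_unramifiedMap_faceLoopLift (k : Fin N) (v : White N) (t : unitInterval) :
    (unramifiedMap N (faceLoopLift k v t) : OnePoint ℂ) = (faceLoop N k t : ℂ) :=
  faceMap_rootLoop k t.2.1 t.2.2

theorem faceLoopLift_zero (k : Fin N) (v : White N) : faceLoopLift k v 0 = whiteFibre v := by
  refine Subtype.ext ?_
  refine (point_one k 0 v rootLoop_zero).trans ?_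
  rw [coe_whiteFibre, whitePoint]
  exact congrArg (point 0 v) (Subtype.ext rootLoop_zero)

theorem faceLoopLift_one (k : Fin N) (v : White N) :
    faceLoopLift k v 1 = whiteFibre (opposite k v) := by
  refine Subtype.ext ?_
  rw [coe_whiteFibre, whitePoint]
  refine (point_turn k v _ ⟨1, by simp⟩ ?_).trans (point_one k 0 _ rfl)
  change (1 : ℂ) = -rootLoop 1
  rw [rootLoop_one, neg_neg]

/-- `faceLoop` as a loop in the base. -/
noncomputable def facePath (k : Fin N) : Path (basePoint N) (basePoint N) where
  -- As the projection of a lift, here from the zero vertex, the loop is continuous and avoids the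
  -- punctures without a separate argument.
  toFun t := unramifiedMap N (faceLoopLift k ⟨0, by simp⟩ t)
  continuous_toFun :=
    isCoveringMap_unramifiedMap.continuous.comp (faceLoopLift k ⟨0, by simp⟩).continuous
  source' := by rw [faceLoopLift_zero]; exact (whiteFibre _).2
  target' := by rw [faceLoopLift_one]; exact (whiteFibre _).2

theorem coe_facePath (k : Fin N) (t : unitInterval) :
    (facePath k t : OnePoint ℂ) = (faceLoop N k t : ℂ) :=
  coe_unramifiedMap_faceLoopLift k _ t

theorem monodromy_facePath (hf : IsCoveringMap (unramifiedMap N)) (k : Fin N) (v : White N) :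
    hf.monodromy (Path.Homotopic.Quotient.mk (facePath k)) (whiteFibre v)
      = whiteFibre (opposite k v) :=
  hf.monodromy_mk_eq (facePath k) (faceLoopLift k v)
    (fun t => Subtype.ext ((coe_unramifiedMap_faceLoopLift k v t).trans (coe_facePath k t).symm))
    (faceLoopLift_zero k v) (faceLoopLift_one k v)

end Loops

end CubeSurface

/-! ### Products of permutations with disjoint supports. -/

/-- A product of commuting pieces of an involution-like map `T`, indexed by the classes of `rep`. -/
theorem List.prod_map_perm_apply {α ι : Type*} [DecidableEq ι] {T : α → α} {rep : α → ι}
    (hT : ∀ x, rep (T x) = rep x) {σ : ι → Equiv.Perm α} (L : List ι) (hL : L.Nodup)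
    (hσ : ∀ j ∈ L, ∀ x, σ j x = if rep x = j then T x else x) (x : α) :
    (L.map σ).prod x = if rep x ∈ L then T x else x := by
  induction L with
  | nil => simp
  | cons j L ih =>
    rw [List.nodup_cons] at hL
    rw [List.map_cons, List.prod_cons, Equiv.Perm.mul_apply,
      ih hL.2 fun i hi => hσ i (List.mem_cons_of_mem _ hi), hσ j List.mem_cons_self]
    -- If a later factor has already moved x, its class is not `j`, because the list has no
    -- duplicates; the factor at `j` then leaves `T x` fixed.
    by_cases h1 : rep x ∈ L
    · have h2 : rep x ≠ j := fun h => hL.1 (h ▸ h1)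
      simp [h1, hT, h2]
    · simp [h1]

namespace CubeSurface

/-! ### Binary digits -/

theorem xor_two_pow (m p : ℕ) :
    m ^^^ 2 ^ p = if m.testBit p then m - 2 ^ p else m + 2 ^ p := by
  induction p generalizing m with
  | zero =>
    have h1 : (m ^^^ 1) / 2 = m / 2 := by rw [Nat.xor_div_two]; simp
    have h2 := @Nat.xor_mod_two_eq m 1
    rw [pow_zero, Nat.testBit_zero]
    by_cases h : m % 2 = 1
    · rw [if_pos (by simpa using h)]; omega
    · rw [if_neg (by simpa using h)]; omega
  | succ p ih =>
    have h1 : (m ^^^ 2 ^ (p + 1)) / 2 = m / 2 ^^^ 2 ^ p := by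
      rw [Nat.xor_div_two, pow_succ, Nat.mul_div_cancel _ two_pos]
    have h2 := @Nat.xor_mod_two_eq m (2 ^ (p + 1))
    have h3 := ih (m / 2)
    rw [← Nat.testBit_succ] at h3
    have h4 := pow_succ 2 p
    by_cases h : m.testBit (p + 1) = true
    · have h5 := Nat.ge_two_pow_of_testBit h
      rw [if_pos h] at h3 ⊢
      omega
    · rw [if_neg h] at h3 ⊢
      omega

theorem testBit_eq_false_iff (m p : ℕ) : m.testBit p = false ↔ m / 2 ^ p % 2 = 0 := by
  rw [Nat.testBit_eq_decide_div_mod_eq]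
  simp

/-- Labels start at 1, digits belong to m = j - 1. The lower bound excludes j ≡ 0 mod b, which is
the largest residue of m. -/
theorem succ_mod_mem_iff {m a b : ℕ} (ha : 0 < a) (hab : a < b) :
    (1 ≤ (m + 1) % b ∧ (m + 1) % b ≤ a) ↔ m % b < a := by
  have h := Nat.mod_lt m (ha.trans hab)
  rw [Nat.add_mod, Nat.mod_eq_of_lt (show 1 < b by omega)]
  rcases (show m % b + 1 ≤ b from h).eq_or_lt with h' | h'
  · rw [h', Nat.mod_self]
    omega
  · rw [Nat.mod_eq_of_lt h']
    omega

theorem succ_mod_iff_testBit (m p : ℕ) :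
    (1 ≤ (m + 1) % 2 ^ (p + 1) ∧ (m + 1) % 2 ^ (p + 1) ≤ 2 ^ p) ↔ m.testBit p = false := by
  have ha : 0 < 2 ^ p := by positivity
  rw [succ_mod_mem_iff ha (by rw [pow_succ]; omega), pow_succ, Nat.mod_mul, testBit_eq_false_iff]
  have h1 := Nat.mod_lt m ha
  rcases Nat.mod_two_eq_zero_or_one (m / 2 ^ p) with h | h <;> simp [h, h1]

theorem succ_mod_iff_testBit_testBit (m p : ℕ) :
    (1 ≤ (m + 1) % 2 ^ (p + 2) ∧ (m + 1) % 2 ^ (p + 2) ≤ 2 ^ p) ↔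
      m.testBit p = false ∧ m.testBit (p + 1) = false := by
  have ha : 0 < 2 ^ p := by positivity
  rw [succ_mod_mem_iff ha (by rw [pow_add]; omega), pow_add, Nat.mod_mul, testBit_eq_false_iff,
    testBit_eq_false_iff, pow_succ 2 p, ← Nat.div_div_eq_div_mul]
  have h1 := Nat.mod_lt m ha
  generalize m / 2 ^ p = q
  constructor
  · intro h
    have : q % 2 ^ 2 = 0 := by
      by_contra h0
      have : 2 ^ p * 1 ≤ 2 ^ p * (q % 2 ^ 2) := Nat.mul_le_mul_left _ (Nat.pos_of_ne_zero h0)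
      omega
    omega
  · intro h
    have : q % 2 ^ 2 = 0 := by omega
    rw [this]
    omega

/-- `m` with its binary digit `p` replaced by `0`. -/
def clearBit (p m : ℕ) : ℕ := if m.testBit p then m ^^^ 2 ^ p else m

theorem testBit_xor_two_pow (m p q : ℕ) :
    (m ^^^ 2 ^ p).testBit q = (m.testBit q ^^ decide (p = q)) := by
  rw [Nat.testBit_xor, Nat.testBit_two_pow]

theorem testBit_clearBit (p q m : ℕ) :
    (clearBit p m).testBit q = (m.testBit q && !decide (p = q)) := by
  unfold clearBit
  split_ifs with h
  · rw [testBit_xor_two_pow]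
    by_cases hpq : p = q
    · subst hpq; simp [h]
    · simp [hpq]
  · by_cases hpq : p = q
    · subst hpq; simpa using h
    · simp [hpq]

theorem clearBit_xor_self (p m : ℕ) : clearBit p (m ^^^ 2 ^ p) = clearBit p m := by
  refine Nat.eq_of_testBit_eq fun i => ?_
  rw [testBit_clearBit, testBit_clearBit, testBit_xor_two_pow]
  by_cases h : p = i <;> simp [h]

theorem clearBit_xor_of_ne {p q : ℕ} (hpq : p ≠ q) (m : ℕ) :
    clearBit p (m ^^^ 2 ^ q) = clearBit p m ^^^ 2 ^ q := by
  refine Nat.eq_of_testBit_eq fun i => ?_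
  rw [testBit_clearBit, testBit_xor_two_pow, testBit_xor_two_pow, testBit_clearBit]
  by_cases h : p = i
  · subst h; simp [hpq.symm]
  · simp [h]

theorem clearBit_eq_self {p m : ℕ} (h : m.testBit p = false) : clearBit p m = m := by
  simp [clearBit, h]

theorem clearBit_le (p m : ℕ) : clearBit p m ≤ m := by
  unfold clearBit
  split_ifs with h
  · rw [xor_two_pow, if_pos h]; exact Nat.sub_le _ _
  · exact le_rfl

theorem eq_or_eq_xor_of_clearBit {p m m' : ℕ} (h : clearBit p m = m') :
    m = m' ∨ m = m' ^^^ 2 ^ p := by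
  unfold clearBit at h
  split_ifs at h
  · exact Or.inr (by rw [← h, Nat.xor_xor_cancel_right])
  · exact Or.inl h

/-! ### The permutations `ρ_i` on labels -/

variable {N : ℕ}

/-- The label `j` with the binary digits of `j - 1` changed at the digits of `x`. -/
def xorLabel (x : ℕ) (hx : x < 2 ^ (N - 1)) (j : Label N) : Label N :=
  ⟨((j : ℕ) - 1 ^^^ x) + 1, Finset.mem_Icc.2 ⟨Nat.le_add_left _ _, by
    have := Finset.mem_Icc.1 j.2
    exact Nat.xor_lt_two_pow (by omega) hx⟩⟩

theorem coe_xorLabel_sub_one {x : ℕ} (hx : x < 2 ^ (N - 1)) (j : Label N) :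
    (xorLabel x hx j : ℕ) - 1 = (j : ℕ) - 1 ^^^ x := rfl

theorem label_ext {j j' : Label N} (h : (j : ℕ) - 1 = (j' : ℕ) - 1) : j = j' := by
  have h1 := Finset.mem_Icc.1 j.2
  have h2 := Finset.mem_Icc.1 j'.2
  exact Subtype.ext (by omega)

theorem coe_sub_one_add_one (j : Label N) : (j : ℕ) - 1 + 1 = j :=
  Nat.sub_add_cancel (Finset.mem_Icc.1 j.2).1

theorem coe_sub_one_lt (j : Label N) : (j : ℕ) - 1 < 2 ^ (N - 1) := by
  have := Finset.mem_Icc.1 j.2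
  omega

theorem transposition_apply {a b : ℕ} {j j' x : Label N} (ha : (j : ℕ) = a) (hb : (j' : ℕ) = b) :
    transposition N a b x = if x = j then j' else if x = j' then j else x := by
  subst ha hb
  rw [transposition, dif_pos ⟨j.2, j'.2⟩]
  exact Equiv.swap_apply_def _ _ _

theorem coe_xorLabel_of_testBit {p : ℕ} (hp : 2 ^ p < 2 ^ (N - 1)) {j : Label N}
    (h : ((j : ℕ) - 1).testBit p = false) : (xorLabel (2 ^ p) hp j : ℕ) = j + 2 ^ p := by
  have h1 : (xorLabel (2 ^ p) hp j : ℕ) = ((j : ℕ) - 1 ^^^ 2 ^ p) + 1 := rfl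
  have h2 := coe_sub_one_add_one j
  rw [h1, xor_two_pow, if_neg (by simp [h])]
  omega

/-- The odd j are those for which digit 0 of j - 1 vanishes: one index for each pair of labels that
differ in that digit only. -/
theorem rho_one_apply (h1 : 2 ^ 0 < 2 ^ (N - 1)) (x : Label N) :
    rho N 1 x = xorLabel (2 ^ 0) h1 x := by
  rw [rho, if_pos rfl, List.prod_map_perm_apply (T := xorLabel (2 ^ 0) h1)
    (rep := fun x => clearBit 0 ((x : ℕ) - 1) + 1) ?_ _ ((List.nodup_range' (s := 1)).filter _) ?_, if_pos]
  · have := clearBit_le 0 ((x : ℕ) - 1)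
    have := coe_sub_one_lt x
    have hb := testBit_clearBit 0 0 ((x : ℕ) - 1)
    rw [decide_eq_true rfl, Bool.not_true, Bool.and_false, testBit_eq_false_iff] at hb
    simp only [List.mem_filter, List.mem_range'_1, decide_eq_true_eq]
    omega
  · intro x
    rw [coe_xorLabel_sub_one, clearBit_xor_self]
  · intro j hj x
    simp only [List.mem_filter, List.mem_range'_1, decide_eq_true_eq] at hj
    lift j to Label N using Finset.mem_Icc.2 (by omega)
    have hb : ((j : ℕ) - 1).testBit 0 = false := by
      rw [testBit_eq_false_iff]
      omega
    rw [transposition_apply (b := (j : ℕ) + 1) (j := j) (j' := xorLabel (2 ^ 0) h1 j) rfl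
      (coe_xorLabel_of_testBit h1 hb)]
    by_cases hx : x = j
    · subst hx
      simp [clearBit_eq_self hb, coe_sub_one_add_one]
    · rw [if_neg hx]
      by_cases hx' : x = xorLabel (2 ^ 0) h1 j
      · rw [if_pos hx', if_pos]
        · apply label_ext
          rw [hx', coe_xorLabel_sub_one, coe_xorLabel_sub_one, Nat.xor_xor_cancel_right]
        · rw [hx', coe_xorLabel_sub_one, clearBit_xor_self, clearBit_eq_self hb,
            coe_sub_one_add_one]
      · rw [if_neg hx', if_neg]
        intro hr
        have h2 : clearBit 0 ((x : ℕ) - 1) = (j : ℕ) - 1 := by omega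
        rcases eq_or_eq_xor_of_clearBit h2 with h | h
        · exact hx (label_ext h)
        · exact hx' (label_ext h)

/-- The labels fall into classes of four that agree outside digits p and p + 1. The index j is the
member with both digits 0, and its two transpositions flip both digits throughout the class. -/
theorem rho_add_two_apply {p : ℕ} (h1 : 2 ^ p < 2 ^ (N - 1)) (h2 : 2 ^ (p + 1) < 2 ^ (N - 1))
    (x : Label N) :
    rho N (p + 2) x = xorLabel (2 ^ (p + 1)) h2 (xorLabel (2 ^ p) h1 x) := by
  have hne : p ≠ p + 1 := by omega
  set A := xorLabel (2 ^ p) h1 with hA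
  set B := xorLabel (2 ^ (p + 1)) h2 with hB
  have hAA : ∀ j, A (A j) = j := fun j => label_ext (by
    rw [hA, coe_xorLabel_sub_one, coe_xorLabel_sub_one, Nat.xor_xor_cancel_right])
  have hBB : ∀ j, B (B j) = j := fun j => label_ext (by
    rw [hB, coe_xorLabel_sub_one, coe_xorLabel_sub_one, Nat.xor_xor_cancel_right])
  have hAB : ∀ j, A (B j) = B (A j) := fun j => label_ext (by
    rw [hA, hB]
    simp only [coe_xorLabel_sub_one]
    rw [Nat.xor_assoc, Nat.xor_comm (2 ^ (p + 1)), ← Nat.xor_assoc])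
  have bA : ∀ j q, ((A j : ℕ) - 1).testBit q = (((j : ℕ) - 1).testBit q ^^ decide (p = q)) :=
    fun j q => by rw [hA, coe_xorLabel_sub_one, testBit_xor_two_pow]
  have bB : ∀ j q, ((B j : ℕ) - 1).testBit q = (((j : ℕ) - 1).testBit q ^^ decide (p + 1 = q)) :=
    fun j q => by rw [hB, coe_xorLabel_sub_one, testBit_xor_two_pow]
  have hrepA : ∀ x : Label N, clearBit p (clearBit (p + 1) ((A x : ℕ) - 1))
      = clearBit p (clearBit (p + 1) ((x : ℕ) - 1)) := fun x => by
    rw [hA, coe_xorLabel_sub_one, clearBit_xor_of_ne hne.symm, clearBit_xor_self]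
  have hrepB : ∀ x : Label N, clearBit p (clearBit (p + 1) ((B x : ℕ) - 1))
      = clearBit p (clearBit (p + 1) ((x : ℕ) - 1)) := fun x => by
    rw [hB, coe_xorLabel_sub_one, clearBit_xor_self]
  rw [rho, if_neg (by omega), List.prod_map_perm_apply (T := fun x => B (A x))
    (rep := fun x : Label N => clearBit p (clearBit (p + 1) ((x : ℕ) - 1)) + 1) ?_ _
    ((List.nodup_range' (s := 1)).filter _) ?_, if_pos]
  · have e1 := clearBit_le p (clearBit (p + 1) ((x : ℕ) - 1))
    have e2 := clearBit_le (p + 1) ((x : ℕ) - 1)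
    have e3 := coe_sub_one_lt x
    simp only [List.mem_filter, List.mem_range'_1, decide_eq_true_eq]
    refine ⟨by omega, (succ_mod_iff_testBit_testBit _ _).2 ⟨?_, ?_⟩⟩
    · simp [testBit_clearBit]
    · simp [testBit_clearBit]
  · intro x
    rw [hrepB, hrepA]
  · intro j hj x
    simp only [List.mem_filter, List.mem_range'_1, decide_eq_true_eq] at hj
    lift j to Label N using Finset.mem_Icc.2 (by omega)
    have hj' := hj.2
    rw [← coe_sub_one_add_one j] at hj'
    obtain ⟨b1, b2⟩ := (succ_mod_iff_testBit_testBit _ _).1 hj'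
    have vA : (A j : ℕ) = j + 2 ^ p := coe_xorLabel_of_testBit h1 b1
    have vB : (B j : ℕ) = j + 2 ^ (p + 1) := coe_xorLabel_of_testBit h2 b2
    have vBA : (B (A j) : ℕ) = j + 2 ^ p + 2 ^ (p + 1) := by
      rw [← vA]
      exact coe_xorLabel_of_testBit h2 (by rw [bA, b2]; simp)
    have hrepj : clearBit p (clearBit (p + 1) ((j : ℕ) - 1)) + 1 = j := by
      rw [clearBit_eq_self b2, clearBit_eq_self b1, coe_sub_one_add_one]
    have hdist : ∀ {a b : Label N} (q : ℕ),
        ((a : ℕ) - 1).testBit q ≠ ((b : ℕ) - 1).testBit q → a ≠ b := by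
      rintro a b q h rfl
      exact h rfl
    have n1 : A j ≠ j := hdist p (by simp [bA])
    have n2 : B j ≠ j := hdist (p + 1) (by simp [bB])
    have n3 : B (A j) ≠ A j := hdist (p + 1) (by simp [bB])
    have n4 : B (A j) ≠ B j := hdist p (by simp [bB, bA])
    rw [Equiv.Perm.mul_apply, show p + 2 - 2 = p by omega, show p + 2 - 1 = p + 1 by omega,
      transposition_apply vA vB, transposition_apply rfl vBA]
    by_cases x1 : x = j
    · subst x1
      rw [if_neg n1.symm, if_neg n2.symm, if_pos rfl, if_pos hrepj]
    by_cases x2 : x = A j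
    · rw [if_pos x2, if_neg n2, if_neg n4.symm, x2, hrepA, if_pos hrepj, hAA]
    by_cases x3 : x = B j
    · rw [if_neg x2, if_pos x3, if_neg n1, if_neg n3.symm, x3, hrepB, if_pos hrepj, hAB, hBB]
    by_cases x4 : x = B (A j)
    · rw [if_neg x2, if_neg x3, if_neg x1, if_pos x4, x4, hrepB, hrepA, if_pos hrepj, hAB, hBB, hAA]
    · rw [if_neg x2, if_neg x3, if_neg x1, if_neg x4, if_neg]
      intro hr
      have h3 : clearBit p (clearBit (p + 1) ((x : ℕ) - 1)) = (j : ℕ) - 1 := by omega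
      rcases eq_or_eq_xor_of_clearBit h3 with h | h <;>
        rcases eq_or_eq_xor_of_clearBit h with h | h
      · exact x1 (label_ext h)
      · exact x3 (label_ext h)
      · exact x2 (label_ext h)
      · exact x4 (label_ext h)

/-! ### Labellings of the cube -/

section Labelling

variable {N : ℕ} [NeZero N]

/-- Positivity matters: truncated subtraction makes `colour N 0` equal to `colour N 1`. -/
theorem colour_succ {i : ℕ} (hi : 1 ≤ i) : colour N (i + 1) = colour N i + 1 := by
  obtain ⟨i, rfl⟩ := Nat.exists_eq_add_of_le' hi
  apply Fin.ext
  simp [colour, Fin.ofNat, Fin.val_add]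

theorem colour_val {i : ℕ} (hi : i - 1 < N) : (colour N i : ℕ) = i - 1 := Nat.mod_eq_of_lt hi

theorem colour_ne_succ {i : ℕ} (hi : 1 ≤ i) (hi' : i ≤ N - 1) : colour N i ≠ colour N i + 1 := by
  intro h
  rw [← colour_succ hi] at h
  have := congrArg Fin.val h
  rw [colour_val (by omega), colour_val (by omega)] at this
  omega

/-- Even weight determines the first coordinate from the others. -/
theorem white_ext {v v' : White N} (h : ∀ k ≠ 0, v.1 k = v'.1 k) : v = v' := by
  refine Subtype.ext (funext fun k => ?_)
  by_cases hk : k = 0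
  · subst hk
    have h1 := even_hammingNorm_iff.1 v.2
    have h2 := even_hammingNorm_iff.1 v'.2
    rw [← Finset.add_sum_erase _ _ (Finset.mem_univ 0)] at h1 h2
    rw [Finset.sum_congr rfl fun k hk => h k (Finset.ne_of_mem_erase hk)] at h1
    exact add_right_cancel (h1.trans h2.symm)
  · exact h k hk

/-- The colour `1` matches the white vertices with the black ones. -/
def whiteEquivBlack (k : Fin N) : White N ≃ Black N where
  toFun := toBlack k
  invFun := toWhite k
  left_inv := toWhite_toBlack k
  right_inv := toBlack_toWhite k

/-- The white vertex whose coordinates other than the first are the binary digits of `m`. -/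
def digitVertex (N : ℕ) [NeZero N] (m : ℕ) : White N :=
  let u : Fin N → ZMod 2 := fun k => if k ≠ 0 ∧ m.testBit ((k : ℕ) - 1) then 1 else 0
  ⟨u + Pi.single 0 (∑ k, u k), even_hammingNorm_iff.2 (by
    simp only [Pi.add_apply, Finset.sum_add_distrib, Finset.sum_pi_single', Finset.mem_univ,
      if_true]
    exact CharTwo.add_self_eq_zero _)⟩

theorem digitVertex_apply {k : Fin N} (hk : k ≠ 0) (m : ℕ) :
    (digitVertex N m).1 k = if m.testBit ((k : ℕ) - 1) then 1 else 0 := by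
  simp [digitVertex, hk]

theorem digitVertex_injOn {m m' : ℕ} (hm : m < 2 ^ (N - 1)) (hm' : m' < 2 ^ (N - 1))
    (h : digitVertex N m = digitVertex N m') : m = m' := by
  refine Nat.eq_of_testBit_eq fun i => ?_
  by_cases hi : i < N - 1
  · have hk : (⟨i + 1, by omega⟩ : Fin N) ≠ 0 := fun h0 => by
      have := congrArg Fin.val h0
      simp at this
    have h1 := congrArg (fun v : White N => v.1 ⟨i + 1, by omega⟩) h
    simp only [digitVertex_apply hk, Nat.add_sub_cancel] at h1
    cases h2 : m.testBit i <;> cases h3 : m'.testBit i <;> simp_all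
  · have hp : 2 ^ (N - 1) ≤ 2 ^ i := Nat.pow_le_pow_right two_pos (by omega)
    rw [Nat.testBit_lt_two_pow (hm.trans_le hp), Nat.testBit_lt_two_pow (hm'.trans_le hp)]

theorem exists_digitVertex_eq (v : White N) : ∃ m < 2 ^ (N - 1), digitVertex N m = v := by
  have hN : 0 < N := Nat.pos_of_ne_zero (NeZero.ne N)
  refine ⟨Nat.ofBits fun i : Fin (N - 1) => decide (v.1 ⟨i + 1, by omega⟩ = 1),
    Nat.ofBits_lt_two_pow _, white_ext fun k hk => ?_⟩
  have hk0 : (k : ℕ) ≠ 0 := fun h => hk (Fin.ext (by simpa using h))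
  have hk2 := k.2
  rw [digitVertex_apply hk, Nat.testBit_ofBits_lt _ _ (by omega)]
  have : (⟨(k : ℕ) - 1 + 1, by omega⟩ : Fin N) = k := Fin.ext (by simp; omega)
  simp only [this, decide_eq_true_eq]
  generalize v.1 k = a
  revert a
  decide

theorem digitVertex_xor {p : ℕ} (hp : p + 1 < N) (m : ℕ) :
    (digitVertex N (m ^^^ 2 ^ p)) =
      toWhite 0 (toBlack (colour N (p + 2)) (digitVertex N m)) := by
  have hc : colour N (p + 2) = ⟨p + 1, hp⟩ := Fin.ext (colour_val (by omega))
  refine white_ext fun k hk => ?_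
  have hk0 : (k : ℕ) ≠ 0 := fun h => hk (Fin.ext (by simpa using h))
  change _ = ((digitVertex N m).1 + Pi.single (colour N (p + 2)) 1 + Pi.single 0 1 :
    Fin N → ZMod 2) k
  rw [Pi.add_apply, Pi.add_apply, Pi.single_eq_of_ne hk, add_zero, digitVertex_apply hk,
    digitVertex_apply hk, testBit_xor_two_pow, hc]
  by_cases h : k = ⟨p + 1, hp⟩
  · subst h
    simp only [Nat.add_sub_cancel, Pi.single_eq_same]
    generalize m.testBit p = c
    revert c
    decide
  · rw [Pi.single_eq_of_ne h, add_zero]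
    have : p ≠ (k : ℕ) - 1 := fun h' => h (Fin.ext (by simp; omega))
    simp [this]

variable (N) in
/-- A labelling of the white vertices by binary digits. -/
noncomputable def digitLabelling : Label N ≃ White N :=
  Equiv.ofBijective (fun j => digitVertex N ((j : ℕ) - 1))
    ⟨fun j j' h => label_ext (digitVertex_injOn (coe_sub_one_lt j) (coe_sub_one_lt j') h),
      fun v => by
        obtain ⟨m, hm, h⟩ := exists_digitVertex_eq v
        exact ⟨⟨m + 1, Finset.mem_Icc.2 ⟨by omega, hm⟩⟩, h⟩⟩

omit [NeZero N] in
theorem two_pow_lt {p : ℕ} (hp : p + 1 < N) : 2 ^ p < 2 ^ (N - 1) :=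
  Nat.pow_lt_pow_right one_lt_two (by omega)

-- With p = c - 2, this identifies the arithmetic rule for colour c with the flip of one binary
-- digit.
omit [NeZero N] in
theorem coe_xorLabel_two_pow {p : ℕ} (hp : 2 ^ p < 2 ^ (N - 1)) (j : Label N) :
    (xorLabel (2 ^ p) hp j : ℕ) =
      if 1 ≤ (j : ℕ) % 2 ^ (p + 1) ∧ (j : ℕ) % 2 ^ (p + 1) ≤ 2 ^ p
        then (j : ℕ) + 2 ^ p else (j : ℕ) - 2 ^ p := by
  have h := succ_mod_iff_testBit ((j : ℕ) - 1) p
  have h1 : (xorLabel (2 ^ p) hp j : ℕ) = ((j : ℕ) - 1 ^^^ 2 ^ p) + 1 := rfl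
  have h2 := coe_sub_one_add_one j
  rw [h2] at h
  simp only [h, h1, xor_two_pow]
  cases hb : ((j : ℕ) - 1).testBit p with
  | false => simp; omega
  | true =>
    have := Nat.ge_two_pow_of_testBit hb
    simp
    omega

-- Shows that the statement about all labellings is not vacuous.
variable (N) in
theorem isCubeLabelling_digitLabelling :
    IsCubeLabelling N (digitLabelling N) ((digitLabelling N).trans (whiteEquivBlack 0)) where
  colour_one _ := rfl
  colour_ge_two c hc hcN j := by
    obtain ⟨p, rfl⟩ := Nat.exists_eq_add_of_le' hc
    refine ⟨xorLabel (2 ^ p) (two_pow_lt (by omega)) j, coe_xorLabel_two_pow _ j, ?_⟩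
    change (toBlack 0 (digitVertex N ((j : ℕ) - 1 ^^^ 2 ^ p))).1 =
      (toBlack (colour N (p + 2)) (digitVertex N ((j : ℕ) - 1))).1
    rw [digitVertex_xor (by omega), toBlack_toWhite]

omit [NeZero N] in
theorem card_label : Nat.card (Label N) = 2 ^ (N - 1) := by simp

variable {w : Label N ≃ White N} {b : Label N ≃ Black N}

/-- Colour p + 2 leads from j_w to j'_b, and colour 1 leads back to j'_w with the same label. Only
the defining rules enter, so this holds in every labelling. -/
theorem IsCubeLabelling.apply_xorLabel (h : IsCubeLabelling N w b) {p : ℕ} (hp : p + 1 < N)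
    (j : Label N) : w (xorLabel (2 ^ p) (two_pow_lt hp) j) =
      toWhite 0 (toBlack (colour N (p + 2)) (w j)) := by
  obtain ⟨j', h1, h2⟩ := h.colour_ge_two (p + 2) (by omega) (by omega) j
  have h3 : j' = xorLabel (2 ^ p) (two_pow_lt hp) j :=
    Subtype.ext (h1.trans (coe_xorLabel_two_pow (two_pow_lt hp) j).symm)
  have h4 : toBlack (colour N (p + 2)) (w j) = toBlack 0 (w j') :=
    Subtype.ext (h2.symm.trans (h.colour_one j'))
  rw [h4, toWhite_toBlack, h3]

/-- `ρ_i` exchanges the two white vertices of every `i`/`(i+1)` face. -/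
theorem IsCubeLabelling.apply_rho (h : IsCubeLabelling N w b) {i : ℕ} (hi : 1 ≤ i)
    (hi' : i ≤ N - 1) (j : Label N) : w (rho N i j) = opposite (colour N i) (w j) := by
  rcases hi.eq_or_lt with rfl | hi2
  · rw [rho_one_apply (two_pow_lt (by omega)), h.apply_xorLabel (by omega), opposite_eq,
      ← colour_succ le_rfl]
    rfl
  · obtain ⟨p, rfl⟩ := Nat.exists_eq_add_of_le' hi2
    rw [rho_add_two_apply (two_pow_lt (by omega)) (two_pow_lt (by omega)),
      h.apply_xorLabel (by omega), h.apply_xorLabel (by omega), opposite,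
      ← colour_succ (by omega)]
    -- The two passages along colour 1 cancel.
    refine Subtype.ext ?_
    change flipAt 0 (flipAt (colour N (p + 1 + 2)) (flipAt 0 (flipAt (colour N (p + 2)) _))) =
      flipAt (colour N (p + 2 + 1)) (flipAt (colour N (p + 2)) _)
    rw [flipAt_comm 0, flipAt_flipAt]

theorem IsCubeLabelling.rho_ne_one (h : IsCubeLabelling N w b) {i : ℕ} (hi : 1 ≤ i)
    (hi' : i ≤ N - 1) : rho N i ≠ 1 := by
  intro h1
  obtain ⟨j, hj⟩ := w.surjective ⟨0, by simp⟩
  have h2 := h.apply_rho hi hi' j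
  rw [h1, Equiv.Perm.one_apply, hj] at h2
  have h3 : (0 : ZMod 2) = ((0 + Pi.single (colour N i) 1 + Pi.single (colour N i + 1) 1 :
    Fin N → ZMod 2) (colour N i)) := congrArg (fun v : White N => v.1 (colour N i)) h2
  simp [Pi.single_eq_of_ne (colour_ne_succ hi hi')] at h3

theorem IsCubeLabelling.rho_mul_self (h : IsCubeLabelling N w b) {i : ℕ} (hi : 1 ≤ i)
    (hi' : i ≤ N - 1) : rho N i * rho N i = 1 := by
  refine Equiv.ext fun j => w.injective ?_
  rw [Equiv.Perm.mul_apply, h.apply_rho hi hi', h.apply_rho hi hi', opposite_opposite]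
  rfl

theorem eq_or_eq_opposite {k : Fin N} {v₁ v₂ : White N} {v : Fin N → ZMod 2}
    (h₁ : v₁.1 ∈ twoColouredLoop k (k + 1) v) (h₂ : v₂.1 ∈ twoColouredLoop k (k + 1) v) :
    v₁ = v₂ ∨ v₂ = opposite k v₁ := by
  have e : ∀ x y : Fin N → ZMod 2, y = flipAt (k + 1) (flipAt k x) → v₁.1 = x → v₂.1 = y →
      v₂ = opposite k v₁ := by
    rintro x y hxy h1 h2
    refine Subtype.ext ?_
    rw [h2, hxy, ← h1]
    rfl
  have p₁ := even_hammingNorm_iff.1 v₁.2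
  have p₂ := even_hammingNorm_iff.1 v₂.2
  simp only [twoColouredLoop, Set.mem_insert_iff, Set.mem_singleton_iff] at h₁ h₂
  rcases h₁ with h₁ | h₁ | h₁ | h₁ <;> rcases h₂ with h₂ | h₂ | h₂ | h₂
  -- The three alternatives: the same corner, diagonal corners, and adjacent corners, which have
  -- opposite parities.
  all_goals first
    | exact Or.inl (Subtype.ext (h₁.trans h₂.symm))
    | (refine Or.inr (e _ _ ?_ h₁ h₂)
       simp only [flipAt_flipAt, flipAt_comm (k + 1) k]
       done)
    | (exfalso
       rw [h₁] at p₁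
       rw [h₂] at p₂
       simp only [sum_flipAt] at p₁ p₂
       generalize ∑ i, v i = s at p₁ p₂
       revert s
       decide)

theorem IsCubeLabelling.rho_apply_eq_iff (h : IsCubeLabelling N w b) {i : ℕ} (hi : 1 ≤ i)
    (hi' : i ≤ N - 1) {j j' : Label N} (hj : j ≠ j') :
    rho N i j = j' ↔ ∃ v : Fin N → ZMod 2,
      (w j).1 ∈ twoColouredLoop (colour N i) (colour N (i + 1)) v ∧
      (w j').1 ∈ twoColouredLoop (colour N i) (colour N (i + 1)) v := by
  rw [← w.injective.eq_iff, h.apply_rho hi hi', colour_succ hi]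
  constructor
  · intro h1
    rw [← h1]
    exact ⟨(w j).1, Or.inl rfl, Or.inr (Or.inr (Or.inl rfl))⟩
  · rintro ⟨v, h1, h2⟩
    exact ((eq_or_eq_opposite h1 h2).resolve_left fun h => hj (w.injective h)).symm

/-- The translations of the white vertices are generated by the `ρ_i`. -/
theorem IsCubeLabelling.exists_mem_closure (h : IsCubeLabelling N w b) (a : White N) :
    ∃ τ ∈ Subgroup.closure {σ | ∃ i : ℕ, 1 ≤ i ∧ i ≤ N - 1 ∧ σ = rho N i},
      ∀ j, w (τ j) = translate a (w j) := by
  set C := Subgroup.closure {σ | ∃ i : ℕ, 1 ≤ i ∧ i ≤ N - 1 ∧ σ = rho N i} with hC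
  -- The vectors whose translation is realised in `C`. They include e_n + e_{n+1}, hence by
  -- telescoping every e_0 + e_n.
  let A : AddSubmonoid (Fin N → ZMod 2) :=
    { carrier := {x | ∃ τ ∈ C, ∀ j, (w (τ j)).1 = (w j).1 + x}
      zero_mem' := ⟨1, C.one_mem, fun j => (add_zero _).symm⟩
      add_mem' := by
        rintro x y ⟨σ, hσ, hx⟩ ⟨τ, hτ, hy⟩
        refine ⟨τ * σ, C.mul_mem hτ hσ, fun j => ?_⟩
        rw [Equiv.Perm.mul_apply, hy, hx, add_assoc] }
  have hadj : ∀ (n : ℕ) (hn : n + 1 < N),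
      (Pi.single ⟨n, by omega⟩ 1 + Pi.single ⟨n + 1, hn⟩ 1 : Fin N → ZMod 2) ∈ A := by
    intro n hn
    refine ⟨rho N (n + 1), Subgroup.subset_closure ⟨n + 1, by omega, by omega, rfl⟩, fun j => ?_⟩
    have e1 : colour N (n + 1) = ⟨n, by omega⟩ := Fin.ext (colour_val (by omega))
    have e2 : colour N (n + 1 + 1) = ⟨n + 1, hn⟩ := Fin.ext (colour_val (by omega))
    rw [h.apply_rho (by omega) (by omega), ← e1, ← e2, colour_succ (i := n + 1) (by omega), ← add_assoc]
    rfl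
  have hzero : ∀ (n : ℕ) (hn : n < N),
      (Pi.single 0 1 + Pi.single ⟨n, hn⟩ 1 : Fin N → ZMod 2) ∈ A := by
    intro n
    induction n with
    | zero =>
      intro hn
      have : (Pi.single 0 1 + Pi.single ⟨0, hn⟩ 1 : Fin N → ZMod 2) = 0 :=
        funext fun _ => CharTwo.add_self_eq_zero _
      rw [this]
      exact A.zero_mem
    | succ n ih =>
      intro hn
      have h1 := A.add_mem (ih (by omega)) (hadj n hn)
      have h2 : ∀ x y z : Fin N → ZMod 2, x + y + (y + z) = x + z := fun x y z => by
        have h3 : y + y = 0 := funext fun _ => CharTwo.add_self_eq_zero _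
        rw [add_assoc, ← add_assoc y, h3, zero_add]
      rwa [h2] at h1
  have hmem : a.1 ∈ A := by
    -- The terms at coordinate 0 add up to the coordinate sum of a, which vanishes because a is
    -- even.
    have h1 : a.1 = ∑ k, (Pi.single 0 (a.1 k) + Pi.single k (a.1 k)) := by
      have h2 : ∑ k, Pi.single (M := fun _ : Fin N => ZMod 2) 0 (a.1 k)
          = Pi.single 0 (∑ k, a.1 k) :=
        (map_sum (AddMonoidHom.single (fun _ : Fin N => ZMod 2) 0) _ _).symm
      rw [Finset.sum_add_distrib, h2, even_hammingNorm_iff.1 a.2, Pi.single_zero, zero_add,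
        Finset.univ_sum_single]
    rw [h1]
    refine A.sum_mem fun k _ => ?_
    have h3 : a.1 k = 0 ∨ a.1 k = 1 := by
      generalize a.1 k = x
      revert x
      decide
    rcases h3 with h3 | h3
    · rw [h3, Pi.single_zero, Pi.single_zero, add_zero]
      exact A.zero_mem
    · rw [h3]
      exact hzero k k.2
  obtain ⟨τ, hτ, h1⟩ := hmem
  exact ⟨τ, hτ, fun j => Subtype.ext (h1 j)⟩

end Labelling

end CubeSurface

/-! ### Assembly of the theorem. -/

open CubeSurface in
theorem mainTheorem11 (N : ℕ) [NeZero N] :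
    (∃ (w : Label N ≃ White N) (b : Label N ≃ Black N), IsCubeLabelling N w b) ∧
    Continuous (coveringMap N) ∧
    (∀ y ∉ faceCentres N, Nat.card (coveringMap N ⁻¹' {y}) = 2 ^ (N - 1)) ∧
    ∃ hf : IsCoveringMap (unramifiedMap N),
      ∀ (w : Label N ≃ White N) (b : Label N ≃ Black N), IsCubeLabelling N w b →
        ∃ e : Label N ≃ unramifiedMap N ⁻¹' {basePoint N},
          (∀ j : Label N, ((e j : PuncturedSurface N) : CubeSurface N) = whitePoint (w j)) ∧
          (hf.monodromyPerm (basePoint N)).range =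
            (Subgroup.closure {σ | ∃ i : ℕ, 1 ≤ i ∧ i ≤ N - 1 ∧ σ = rho N i}).map
              e.permCongrHom.toMonoidHom ∧
          ∀ i : ℕ, 1 ≤ i → i ≤ N - 1 →
            rho N i ≠ 1 ∧ rho N i * rho N i = 1 ∧
            (∃ γ : Path (basePoint N) (basePoint N),
              (∀ t, (γ t : OnePoint ℂ) = (faceLoop N (colour N i) t : ℂ)) ∧
              hf.monodromyPerm (basePoint N)
                (FundamentalGroup.fromPath (Path.Homotopic.Quotient.mk γ)) =
                e.permCongr (rho N i)) ∧
            ∀ j j' : Label N, j ≠ j' →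
              (rho N i j = j' ↔ ∃ v : Fin N → ZMod 2,
                (w j).1 ∈ twoColouredLoop (colour N i) (colour N (i + 1)) v ∧
                (w j').1 ∈ twoColouredLoop (colour N i) (colour N (i + 1)) v) := by
  have hw : Nat.card (White N) = 2 ^ (N - 1) :=
    (Nat.card_congr (digitLabelling N)).symm.trans card_label
  have hb : Nat.card (Black N) = 2 ^ (N - 1) :=
    (Nat.card_congr (whiteEquivBlack (0 : Fin N))).symm.trans hw
  refine ⟨⟨_, _, isCubeLabelling_digitLabelling N⟩, coveringMap_continuous,
    fun y hy => card_fibre hw hb hy, isCoveringMap_unramifiedMap, fun w b h => ?_⟩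
  set hf := isCoveringMap_unramifiedMap (N := N)
  have hloop : ∀ i, 1 ≤ i → i ≤ N - 1 → hf.monodromyPerm (basePoint N)
      (FundamentalGroup.fromPath (Path.Homotopic.Quotient.mk (facePath (colour N i)))) =
      (w.trans whiteFibre).permCongr (rho N i) := by
    intro i hi hi'
    refine Equiv.ext fun x => ?_
    obtain ⟨j, rfl⟩ := (w.trans whiteFibre).surjective x
    rw [Equiv.permCongr_apply, Equiv.symm_apply_apply, Equiv.trans_apply, Equiv.trans_apply,
      h.apply_rho hi hi']
    exact monodromy_facePath hf (colour N i) (w j)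
  refine ⟨w.trans whiteFibre, fun j => coe_whiteFibre (w j), le_antisymm ?_ ?_,
    fun i hi hi' => ⟨h.rho_ne_one hi hi', h.rho_mul_self hi hi',
      ⟨facePath (colour N i), coe_facePath _, hloop i hi hi'⟩,
      fun j j' hj => h.rho_apply_eq_iff hi hi' hj⟩⟩
  · rintro _ ⟨γ, rfl⟩
    obtain ⟨a, ha⟩ := exists_monodromy_eq_translate hf γ
    obtain ⟨τ, hτ, hτa⟩ := h.exists_mem_closure a
    refine ⟨τ, hτ, Equiv.ext fun x => ?_⟩
    obtain ⟨j, rfl⟩ := (w.trans whiteFibre).surjective x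
    refine Eq.trans ?_ (ha (w j)).symm
    rw [← hτa j]
    exact congrArg (fun j => whiteFibre (w (τ j))) (Equiv.symm_apply_apply _ j)
  · rw [Subgroup.map_le_iff_le_comap, Subgroup.closure_le]
    rintro _ ⟨i, hi, hi', rfl⟩
    exact ⟨_, hloop i hi hi'⟩
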